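/- Let $H$ be a Hermitian matrix on a finite-dimensional complex Hilbert space and let $(A^a)_a$ be a finite family of matrices on it. Write $\|\cdot\|$ for the spectral norm, $\|X\|_1=\operatorname{Tr}\sqrt{X^\dagger X}$ for the trace norm, and $\|\Phi\|_\diamond=\sup_{k}\sup_{X\ne 0}\|(\Phi\otimes \mathrm{id}_k)(X)\|_1/\|X\|_1$ for the diamond norm. For $\beta>0$ put $$\gamma(\omega)=e^{-(\beta\omega+1)^2/2},\qquad f(t)=\frac{e^{-t^2/\beta^2}}{\sqrt{\beta\sqrt{\pi/2}}},$$ $$A^a(\omega)=\frac1{\sqrt{2\pi}}\int_{-\infty}^{\infty} e^{iHt}A^ae^{-iHt}e^{-i\omega t}f(t)\,dt,\qquad \tilde A^a(\omega)=\frac1{\sqrt{2\pi}}\int_{-\infty}^{\infty}\bigl(A^a+t[iH,A^a]\bigr)e^{-i\omega t}f(t)\,dt,$$ and, with $\mathcal D[L](X)=LXL^\dagger-\tfrac12\{L^\dagger L,X\}$, $$\mathcal L=-i[B,\cdot]+\sum_a\int_{-\infty}^{\infty}\gamma(\omega)\,\mathcal D[A^a(\omega)]\,d\omega,\qquad \tilde{\mathcal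 L}=-i[B,\cdot]+\sum_a\int_{-\infty}^{\infty}\gamma(\omega)\,\mathcal D[\tilde A^a(\omega)]\,d\omega .$$ Here $B$ is the coherent term of the exact Gibbs sampler: in an eigenbasis of $H$ with eigenvalues $E_i$, $B_{ij}=\tfrac i2\tanh\bigl(\beta(E_i-E_j)/4\bigr)R_{ij}$, where $R=\sum_a\int\gamma(\omega)A^a(\omega)^\dagger A^a(\omega)\,d\omega$. Let $$\delta_a(\omega)=\delta_{e,a}\,e^{-\beta^2\omega^2/8}+\delta_{o,a}\,|\omega|\,e^{-\beta^2\omega^2/4},$$ $$\delta_{e,a}=\Bigl(\tfrac{2\beta^2}{\pi}\Bigr)^{1/4}\pi^{1/4}(\beta\|H\|)^2\|A^a\|\,e^{(\beta\|H\|)^2}e^{4\beta^2\|H\|^2},\qquad \delta_{o,a}=\frac{\beta^{5/2}}{(2^5\pi)^{1/4}}\frac{\sqrt\pi}{2}\,2\|H\|\,\|A^a\|\,\bigl(e^{4\beta^2\|H\|^2}-1\bigr).$$ Then: 1. $\|A^a(\omega)-\tilde A^a(\omega)\|\le\delta_a(\omega)$ for all $\beta>0$, all $\omega\in\mathbb R$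 and all $a$. 2. If $\beta>0$ and $\|\tilde A^a(\omega)\|\le 1$ for all $a$ and $\omega$, then $\|\mathcal L-\tilde{\mathcal L}\|_\diamond\le \sum_a\int_{-\infty}^\infty\gamma(\omega)\bigl(4\delta_a(\omega)+2\delta_a(\omega)^2\bigr)d\omega$. The condition holds for all sufficiently small $\beta>0$. 3. As $\beta\to0^+$ (with $H$ and $(A^a)$ fixed) the right-hand side in 2 equals $$\sum_a 8\cdot 2^{3/4}\sqrt{\tfrac{\pi}{5}}\;e^{-1/10}\,\|A^a\|\,\|H\|^2\,\beta^{3/2}+O(\beta^{5/2}).$$ 4. Consequently $\|\mathcal L-\tilde{\mathcal L}\|_\diamond=O(\beta^{3/2})$, and hence $O(\beta)$, as $\beta\to0^+$. 5. Suppose moreover that the family $(A^a)$ is closed under adjoints, i.e. there is a permutation $\sigma$ of the index set with $A^{\sigma(a)}=(A^a)^\dagger$ for all $a$. Then the Gibbs state $\rho_\beta=e^{-\beta H}/\operatorname{Tr}e^{-\beta H}$ satisfies $\mathcal L(\rho_\beta)=0$ for every $\beta>0$, and it is an approximate steady state of the truncated evolution at high temperature: $\|\tilde{\mathcal L}(\rho_\beta)\|_1=O(\beta^{3/2})$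 as $\beta\to0^+$. -/

import Mathlib

open MeasureTheory Filter Topology Asymptotics
open scoped Matrix Matrix.Norms.L2Operator

-- `‖M‖` is the spectral (operator) norm of a matrix `M` throughout.

namespace GibbsSampler

noncomputable section

/-- The trace norm `Tr √(Mᴴ M)`: the sum of the singular values of `M`. -/
def traceNorm {m : Type*} [Fintype m] [DecidableEq m] (M : Matrix m m ℂ) : ℝ :=
  ∑ i, √((Matrix.isHermitian_conjTranspose_mul_self M).eigenvalues i)

section System

variable {n ι : Type*} [Fintype n] [DecidableEq n] [Fintype ι]

/-- The action of `Φ ⊗ id` on matrices over the system tensored with a `k`-dimensional ancilla: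
`Φ` is applied to each ancilla block. -/
def extend (Φ : Matrix n n ℂ →L[ℂ] Matrix n n ℂ) {k : ℕ}
    (X : Matrix (n × Fin k) (n × Fin k) ℂ) : Matrix (n × Fin k) (n × Fin k) ℂ :=
  Matrix.of fun p q => Φ (Matrix.of fun i j => X (i, p.2) (j, q.2)) p.1 q.1

/-- The diamond norm: the supremum, over all ancilla dimensions `k` and all `X ≠ 0`, of
`‖(Φ ⊗ id) X‖₁ / ‖X‖₁`. -/
def diamondNorm (Φ : Matrix n n ℂ →L[ℂ] Matrix n n ℂ) : ENNReal :=
  ⨆ (k : ℕ) (X : Matrix (n × Fin k) (n × Fin k) ℂ) (_ : X ≠ 0),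
    ENNReal.ofReal (traceNorm (extend Φ X) / traceNorm X)

/-- The superoperator `X ↦ -i [B, X]`. -/
def coherent (B : Matrix n n ℂ) : Matrix n n ℂ →L[ℂ] Matrix n n ℂ :=
  LinearMap.toContinuousLinearMap
    { toFun := fun X => (-Complex.I) • (B * X - X * B)
      map_add' := fun X Y => by
        rw [← smul_add]; congr 1; simp only [mul_add, add_mul]; abel
      map_smul' := fun c X => by
        simp only [Matrix.mul_smul, Matrix.smul_mul, ← smul_sub, RingHom.id_apply]
        rw [smul_comm] }

/-- The dissipator `X ↦ L X Lᴴ - (1/2) {Lᴴ L, X}`. -/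
def dissipator (L : Matrix n n ℂ) : Matrix n n ℂ →L[ℂ] Matrix n n ℂ :=
  LinearMap.toContinuousLinearMap
    { toFun := fun X => L * X * Lᴴ - (1 / 2 : ℂ) • (Lᴴ * L * X + X * (Lᴴ * L))
      map_add' := fun X Y => by
        simp only [mul_add, add_mul, smul_add]; abel
      map_smul' := fun c X => by
        simp only [Matrix.mul_smul, Matrix.smul_mul, ← smul_add, RingHom.id_apply, smul_sub]
        rw [smul_comm c] }

/-- The transition weight `γ(ω) = exp (-(β ω + 1)² / 2)`. -/
def transitionWeight (β ω : ℝ) : ℝ := Real.exp (-(β * ω + 1) ^ 2 / 2)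

/-- The Gaussian filter `f(t) = exp (-t² / β²) / √(β √(π / 2))`. -/
def gaussianFilter (β t : ℝ) : ℝ :=
  Real.exp (-t ^ 2 / β ^ 2) / √(β * √(Real.pi / 2))

/-- `(2π)^(-1/2) ∫ M(t) e^{-iωt} f(t) dt` for an operator-valued function of time `M`. -/
def filteredTransform (β : ℝ) (M : ℝ → Matrix n n ℂ) (ω : ℝ) : Matrix n n ℂ :=
  ((1 / √(2 * Real.pi) : ℝ) : ℂ) •
    ∫ t : ℝ, (Complex.exp (-Complex.I * ω * t) * (gaussianFilter β t : ℂ)) • M t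

/-- The jump operator `A(ω)`: the filtered transform of `t ↦ e^{iHt} A e^{-iHt}`. -/
def jump (H A : Matrix n n ℂ) (β ω : ℝ) : Matrix n n ℂ :=
  filteredTransform β (fun t => NormedSpace.exp ((Complex.I * t) • H) * A *
    NormedSpace.exp ((-(Complex.I * t)) • H)) ω

/-- The truncated jump operator `Ã(ω)`: the filtered transform of `t ↦ A + t [iH, A]`. -/
def truncatedJump (H A : Matrix n n ℂ) (β ω : ℝ) : Matrix n n ℂ :=
  filteredTransform β (fun t => A + (t : ℂ) • ((Complex.I • H) * A - A * (Complex.I • H))) ω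

/-- The Lindbladian `-i [B, ·] + ∑ₐ ∫ γ(ω) 𝓓[L a ω] dω`. -/
def lindbladian (β : ℝ) (B : Matrix n n ℂ) (L : ι → ℝ → Matrix n n ℂ) :
    Matrix n n ℂ →L[ℂ] Matrix n n ℂ :=
  coherent B + ∑ a, ∫ ω : ℝ, (transitionWeight β ω : ℂ) • dissipator (L a ω)

/-- The decay operator `R = ∑ₐ ∫ γ(ω) A^a(ω)ᴴ A^a(ω) dω`. -/
def decayOperator (H : Matrix n n ℂ) (A : ι → Matrix n n ℂ) (β : ℝ) : Matrix n n ℂ :=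
  ∑ a, ∫ ω : ℝ, (transitionWeight β ω : ℂ) • ((jump H (A a) β ω)ᴴ * jump H (A a) β ω)

/-- The coherent term of the Gibbs sampler: in an eigenbasis of `H` with eigenvalues `Eᵢ` its
matrix elements are `Bᵢⱼ = (i/2) tanh (β (Eᵢ - Eⱼ) / 4) Rᵢⱼ`, that is
`B = ∑_ν (1/(2i)) tanh (-β ν / 4) R_ν` with `R_ν` the component of `R` at Bohr frequency `ν`. -/
def coherentTerm (H : Matrix n n ℂ) (hH : H.IsHermitian) (A : ι → Matrix n n ℂ) (β : ℝ) :
    Matrix n n ℂ :=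
  let U : Matrix n n ℂ := (hH.eigenvectorUnitary : Matrix n n ℂ)
  let R : Matrix n n ℂ := Uᴴ * decayOperator H A β * U
  U * (Matrix.of fun i j => Complex.I / 2 *
    (Real.tanh (β * (hH.eigenvalues i - hH.eigenvalues j) / 4) : ℂ) * R i j) * Uᴴ

/-- The ideal Lindbladian `𝓛` of the Gibbs sampler. -/
def idealLindbladian (H : Matrix n n ℂ) (hH : H.IsHermitian) (A : ι → Matrix n n ℂ) (β : ℝ) :
    Matrix n n ℂ →L[ℂ] Matrix n n ℂ :=
  lindbladian β (coherentTerm H hH A β) fun a ω => jump H (A a) β ω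

/-- The approximate Lindbladian: every `A^a(ω)` in the dissipative part of `𝓛` is replaced by its
truncation; the coherent part is unchanged. -/
def approxLindbladian (H : Matrix n n ℂ) (hH : H.IsHermitian) (A : ι → Matrix n n ℂ) (β : ℝ) :
    Matrix n n ℂ →L[ℂ] Matrix n n ℂ :=
  lindbladian β (coherentTerm H hH A β) fun a ω => truncatedJump H (A a) β ω

/-- The Gibbs state `e^{-βH} / Tr e^{-βH}`. -/
def gibbsState (H : Matrix n n ℂ) (β : ℝ) : Matrix n n ℂ :=
  (NormedSpace.exp ((-β : ℂ) • H)).trace⁻¹ • NormedSpace.exp ((-β : ℂ) • H)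

/-- The coefficient `δ_e` of the even part of the spectral-norm bound. -/
def deltaEven (H A : Matrix n n ℂ) (β : ℝ) : ℝ :=
  (2 * β ^ 2 / Real.pi) ^ (1 / 4 : ℝ) * Real.pi ^ (1 / 4 : ℝ) * (β * ‖H‖) ^ 2 * ‖A‖ *
    Real.exp ((β * ‖H‖) ^ 2) * Real.exp (4 * β ^ 2 * ‖H‖ ^ 2)

/-- The coefficient `δ_o` of the odd part of the spectral-norm bound. -/
def deltaOdd (H A : Matrix n n ℂ) (β : ℝ) : ℝ :=
  β ^ (5 / 2 : ℝ) / (2 ^ 5 * Real.pi) ^ (1 / 4 : ℝ) * (√Real.pi / 2) * (2 * ‖H‖) * ‖A‖ *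
    (Real.exp (4 * β ^ 2 * ‖H‖ ^ 2) - 1)

/-- `δ(ω) = δ_e exp (-β² ω² / 8) + δ_o |ω| exp (-β² ω² / 4)`. -/
def delta (H A : Matrix n n ℂ) (β ω : ℝ) : ℝ :=
  deltaEven H A β * Real.exp (-(β ^ 2 * ω ^ 2) / 8) +
    deltaOdd H A β * |ω| * Real.exp (-(β ^ 2 * ω ^ 2) / 4)

/-- `∑ₐ ∫ γ(ω) (4 δₐ(ω) + 2 δₐ(ω)²) dω`. -/
def errorBound (H : Matrix n n ℂ) (A : ι → Matrix n n ℂ) (β : ℝ) : ℝ :=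
  ∑ a, ∫ ω : ℝ, transitionWeight β ω *
    (4 * delta H (A a) β ω + 2 * delta H (A a) β ω ^ 2)

end System

end

end GibbsSampler

/-! In an eigenbasis of `H` both jump operators are entrywise multiples of `A`. With ν = Eᵢ − Eⱼ,
`jump` carries the factor f̂(ω − ν) and `truncatedJump` the factor f̂(ω)(1 + β²ων/2), where f̂ is
the Gaussian transform of the filter. For x = βω/2 and s = βν/2 one has f̂(ω − ν) = f̂(ω) exp(2xs −
s²), the generating function of the Hermite polynomials, and truncation keeps the terms of degree at
most one in s. Multiplying entries by s is β/2 times the commutator with diag(E), a superoperator S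
of norm at most β‖H‖ in every dimension. The tail of exp(2xS − S²) is therefore estimated in the
Banach algebra of superoperators (`norm_exp_hermite_remainder_le`), through the scalar inequality
`hermite_tail_le`. The even part of δ alone already dominates the result.

Dissipators are quadratic in the jump, so duality between trace norm and spectral norm turns a jump
error δ into a superoperator error 4δ + 2δ². The amplification L ↦ L ⊗ 1 is a contractive
*-homomorphism that commutes with forming dissipators, so the same estimate holds for every ancilla
and bounds the diamond norm. The substitution u = βω reduces the error integral to fixed Gaussian
integrals, whose leading contribution is the linear term 4δ_e.

For stationarity put pᵢ = exp(−βEᵢ/2). A KMS symmetry of the Gaussian overlaps (`filterOverlap_neg`)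
and closure under adjoints make the gain term, at the unnormalised Gibbs state, equal to pᵢpⱼRᵢⱼ.
Gain minus loss is −(pᵢ − pⱼ)²Rᵢⱼ/2, which the tanh in the coherent term cancels exactly. The
truncated statement follows by applying the error estimate to the Gibbs state. -/

namespace GibbsSampler

/-! ### The trace norm and its duality with the spectral norm. -/

section TraceNorm

variable {m : Type*} [Fintype m] [DecidableEq m]

lemma eigenvectorUnitary_star_mul {H : Matrix m m ℂ} (hH : H.IsHermitian) :
    (hH.eigenvectorUnitary : Matrix m m ℂ)ᴴ * (hH.eigenvectorUnitary : Matrix m m ℂ) = 1 := by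
  simpa [Matrix.star_eq_conjTranspose] using Unitary.coe_star_mul_self hH.eigenvectorUnitary

lemma eigenvectorUnitary_mul_star {H : Matrix m m ℂ} (hH : H.IsHermitian) :
    (hH.eigenvectorUnitary : Matrix m m ℂ) * (hH.eigenvectorUnitary : Matrix m m ℂ)ᴴ = 1 := by
  simpa [Matrix.star_eq_conjTranspose] using Unitary.coe_mul_star_self hH.eigenvectorUnitary

lemma eq_eigenvectorUnitary_conj {H : Matrix m m ℂ} (hH : H.IsHermitian) :
    H = (hH.eigenvectorUnitary : Matrix m m ℂ) *
      Matrix.diagonal (fun i => (hH.eigenvalues i : ℂ)) *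
        (hH.eigenvectorUnitary : Matrix m m ℂ)ᴴ := by
  conv_lhs => rw [hH.spectral_theorem]
  rfl

lemma norm_conj_le_of_star_mul_self {U : Matrix m m ℂ} (h1 : Uᴴ * U = 1)
    (M : Matrix m m ℂ) : ‖U * M * Uᴴ‖ ≤ ‖M‖ := by
  -- Only an inequality is available: on an empty index type the identity has norm 0.
  have hU : ‖U‖ ≤ 1 := by
    have h := Matrix.l2_opNorm_conjTranspose_mul_self U
    rw [h1] at h
    have h3 : ‖(1 : Matrix m m ℂ)‖ ≤ 1 := by
      rw [← Matrix.diagonal_one, Matrix.l2_opNorm_diagonal]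
      exact (pi_norm_le_iff_of_nonneg zero_le_one).2 fun _ => by simp
    nlinarith [norm_nonneg U]
  calc ‖U * M * Uᴴ‖ ≤ ‖U‖ * ‖M‖ * ‖Uᴴ‖ :=
        (norm_mul_le _ _).trans (by gcongr; exact norm_mul_le _ _)
    _ ≤ 1 * ‖M‖ * 1 := by
        rw [Matrix.l2_opNorm_conjTranspose]; gcongr
    _ = ‖M‖ := by ring

lemma norm_conj_eq_of_star_mul_self {U : Matrix m m ℂ} (h1 : Uᴴ * U = 1) (h2 : U * Uᴴ = 1)
    (M : Matrix m m ℂ) : ‖U * M * Uᴴ‖ = ‖M‖ := by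
  refine le_antisymm (norm_conj_le_of_star_mul_self h1 M) ?_
  have h := norm_conj_le_of_star_mul_self (U := Uᴴ) (by simpa using h2)
    (U * M * Uᴴ)
  have e : Uᴴ * (U * M * Uᴴ) * Uᴴᴴ = (Uᴴ * U) * M * (Uᴴ * U) := by
    simp only [Matrix.conjTranspose_conjTranspose, Matrix.mul_assoc]
  rwa [e, h1, Matrix.one_mul, Matrix.mul_one] at h

lemma traceNorm_nonneg (M : Matrix m m ℂ) : 0 ≤ traceNorm M :=
  Finset.sum_nonneg fun _ _ => Real.sqrt_nonneg _

omit [DecidableEq m] in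
lemma norm_star_mul_apply_le (P Q : Matrix m m ℂ) (i : m) :
    ‖(Pᴴ * Q) i i‖ ≤ ‖WithLp.toLp 2 (P.col i)‖ * ‖WithLp.toLp 2 (Q.col i)‖ := by
  refine le_of_eq_of_le ?_ (norm_inner_le_norm (𝕜 := ℂ) (WithLp.toLp 2 (P.col i))
    (WithLp.toLp 2 (Q.col i)))
  simp [PiLp.inner_apply, Matrix.mul_apply, mul_comm]

omit [DecidableEq m] in
lemma norm_col_sq (P : Matrix m m ℂ) (i : m) :
    ‖WithLp.toLp 2 (P.col i)‖ ^ 2 = ((Pᴴ * P) i i).re := by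
  rw [EuclideanSpace.norm_sq_eq]
  simp [Matrix.mul_apply, ← Complex.normSq_eq_conj_mul_self, Complex.normSq_eq_norm_sq,
    -Complex.ofReal_pow]

open scoped ComplexOrder in
lemma exists_singularValue_decomposition (M : Matrix m m ℂ) :
    ∃ (W : Matrix m m ℂ) (e : m → ℝ), Wᴴ * W = 1 ∧ W * Wᴴ = 1 ∧
      Mᴴ * M = W * Matrix.diagonal (fun i => (e i : ℂ)) * Wᴴ ∧ (∀ i, 0 ≤ e i) ∧
      traceNorm M = ∑ i, √(e i) :=
  have hM := Matrix.isHermitian_conjTranspose_mul_self M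
  ⟨hM.eigenvectorUnitary, hM.eigenvalues, eigenvectorUnitary_star_mul hM,
    eigenvectorUnitary_mul_star hM, eq_eigenvectorUnitary_conj hM,
    (Matrix.posSemidef_conjTranspose_mul_self M).eigenvalues_nonneg, rfl⟩

/-- Taking the trace in an eigenbasis W of MᴴM gives ∑ᵢ ⟨Weᵢ, V M Weᵢ⟩. Cauchy–Schwarz applies to
each term, and ‖M Weᵢ‖ is the i-th singular value. -/
lemma norm_trace_mul_le (V M : Matrix m m ℂ) : ‖(V * M).trace‖ ≤ ‖V‖ * traceNorm M := by
  obtain ⟨W, ev, h1, h2, hD, -, hT⟩ := exists_singularValue_decomposition M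
  have e : (V * M).trace = (Wᴴ * (V * (M * W))).trace := by
    rw [Matrix.trace_mul_comm Wᴴ, Matrix.mul_assoc, Matrix.mul_assoc, h2, Matrix.mul_one]
  rw [e, Matrix.trace, hT, Finset.mul_sum]
  refine (norm_sum_le _ _).trans (Finset.sum_le_sum fun i _ => ?_)
  refine (norm_star_mul_apply_le W (V * (M * W)) i).trans ?_
  have hW : ‖WithLp.toLp 2 (W.col i)‖ = 1 := by
    have := norm_col_sq W i
    rw [h1] at this
    have h0 := norm_nonneg (WithLp.toLp 2 (W.col i))
    simp only [Matrix.one_apply_eq, Complex.one_re] at this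
    nlinarith
  have hN : ‖WithLp.toLp 2 ((M * W).col i)‖ = √(ev i) := by
    have := norm_col_sq (M * W) i
    have e2 : (M * W)ᴴ * (M * W) = Matrix.diagonal (fun i => (ev i : ℂ)) := by
      rw [Matrix.conjTranspose_mul, Matrix.mul_assoc, ← Matrix.mul_assoc Mᴴ, hD]
      rw [Matrix.mul_assoc _ Wᴴ, h1, Matrix.mul_one, ← Matrix.mul_assoc, h1, Matrix.one_mul]
    rw [e2, Matrix.diagonal_apply_eq, Complex.ofReal_re] at this
    rw [← this, Real.sqrt_sq (norm_nonneg _)]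
  rw [hW, one_mul, ← hN]
  exact Matrix.l2_opNorm_mulVec V (WithLp.toLp 2 ((M * W).col i))

/-- The optimal V is the adjoint of the partial isometry in the polar decomposition, (MᴴM)^(-1/2) Mᴴ
with the pseudo-inverse on the kernel. -/
lemma exists_traceNorm_eq_trace (M : Matrix m m ℂ) :
    ∃ V : Matrix m m ℂ, ‖V‖ ≤ 1 ∧ (V * M).trace = (traceNorm M : ℂ) := by
  obtain ⟨W, ev, h1, h2, hD, hpos, hT⟩ := exists_singularValue_decomposition M
  -- Since the inverse of 0 is 0, zero singular values need no separate definition, and r·ev·r takes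
  -- only the values 0 and 1.
  set r : m → ℂ := fun i => ((√(ev i))⁻¹ : ℝ)
  have e1 : ∀ i, r i * (ev i : ℂ) = (√(ev i) : ℝ) := fun i => by
    simp only [r]
    rw [← Complex.ofReal_mul]
    congr 1
    rcases (hpos i).eq_or_lt with h | h
    · simp [← h]
    · have h3 : √(ev i) ≠ 0 := (Real.sqrt_pos.2 h).ne'
      rw [inv_mul_eq_div, div_eq_iff h3, Real.mul_self_sqrt h.le]
  refine ⟨W * Matrix.diagonal r * Wᴴ * Mᴴ, ?_, ?_⟩
  · set V := W * Matrix.diagonal r * Wᴴ * Mᴴ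
    have hr : (Matrix.diagonal r)ᴴ = Matrix.diagonal r := by
      rw [Matrix.diagonal_conjTranspose]
      congr 1
      ext i
      simp [r]
    have hV : Vᴴᴴ * Vᴴ = W * Matrix.diagonal
        (fun i => r i * (ev i : ℂ) * r i) * Wᴴ := by
      simp only [V, Matrix.conjTranspose_mul, Matrix.conjTranspose_conjTranspose, hr]
      have : W * Matrix.diagonal r * Wᴴ * Mᴴ * (M * (W * (Matrix.diagonal r * Wᴴ))) =
          W * Matrix.diagonal r * Wᴴ * (Mᴴ * M) * (W * (Matrix.diagonal r * Wᴴ)) := by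
        simp only [Matrix.mul_assoc]
      rw [this, hD]
      have : ∀ A B : Matrix m m ℂ, W * A * Wᴴ * (W * B * Wᴴ) * (W * (A * Wᴴ)) =
          W * A * (Wᴴ * W) * B * (Wᴴ * W) * A * Wᴴ := fun A B => by
        simp only [Matrix.mul_assoc]
      rw [this, h1, Matrix.mul_one, Matrix.mul_one, Matrix.mul_assoc W, Matrix.diagonal_mul_diagonal,
        Matrix.mul_assoc W, Matrix.diagonal_mul_diagonal]
    have hn := Matrix.l2_opNorm_conjTranspose_mul_self Vᴴ
    rw [hV, norm_conj_eq_of_star_mul_self h1 h2, Matrix.l2_opNorm_diagonal,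
      Matrix.l2_opNorm_conjTranspose] at hn
    have hle : ‖V‖ * ‖V‖ ≤ 1 := by
      rw [← hn]
      refine (pi_norm_le_iff_of_nonneg zero_le_one).2 fun i => ?_
      rw [e1]
      simp only [r]
      rw [← Complex.ofReal_mul, Complex.norm_real]
      by_cases h : √(ev i) = 0
      · simp [h]
      · rw [mul_inv_cancel₀ h]; simp
    nlinarith [norm_nonneg V]
  · rw [Matrix.mul_assoc _ Mᴴ, hD, ← Matrix.mul_assoc, ← Matrix.mul_assoc,
      Matrix.mul_assoc _ Wᴴ W, h1, Matrix.mul_one, Matrix.mul_assoc W, Matrix.diagonal_mul_diagonal,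
      Matrix.trace_mul_cycle, h1, Matrix.one_mul, Matrix.trace_diagonal, hT,
      Complex.ofReal_sum]
    exact Finset.sum_congr rfl fun i _ => e1 i

lemma traceNorm_mul_mul_le (P M Q : Matrix m m ℂ) :
    traceNorm (P * M * Q) ≤ ‖P‖ * ‖Q‖ * traceNorm M := by
  obtain ⟨V, hV, h⟩ := exists_traceNorm_eq_trace (P * M * Q)
  have e : (V * (P * M * Q)).trace = ((Q * V * P) * M).trace := by
    rw [← Matrix.mul_assoc, ← Matrix.mul_assoc, Matrix.trace_mul_comm]
    simp only [Matrix.mul_assoc]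
  have h3 := norm_trace_mul_le (Q * V * P) M
  rw [← e, h, Complex.norm_real, Real.norm_of_nonneg (traceNorm_nonneg _)] at h3
  refine h3.trans (mul_le_mul_of_nonneg_right ?_ (traceNorm_nonneg _))
  calc ‖Q * V * P‖ ≤ ‖Q‖ * ‖V‖ * ‖P‖ :=
        (norm_mul_le _ _).trans (by gcongr; exact norm_mul_le _ _)
    _ ≤ ‖Q‖ * 1 * ‖P‖ := by gcongr
    _ = ‖P‖ * ‖Q‖ := by ring

/-- The functional `X ↦ Tr (V X)`. -/
noncomputable def traceMul (V : Matrix m m ℂ) : Matrix m m ℂ →L[ℂ] ℂ :=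
  LinearMap.toContinuousLinearMap
    ((Matrix.traceLinearMap m ℂ ℂ).comp (LinearMap.mulLeft ℂ V))

@[simp] lemma traceMul_apply (V X : Matrix m m ℂ) : traceMul V X = (V * X).trace := rfl

/-- The variational form of the trace norm: it reduces the triangle inequality and integral
estimates to linear functionals X ↦ Tr(VX). -/
lemma traceNorm_le_of_forall {M : Matrix m m ℂ} {C : ℝ}
    (h : ∀ V : Matrix m m ℂ, ‖V‖ ≤ 1 → ‖(V * M).trace‖ ≤ C) : traceNorm M ≤ C := by
  obtain ⟨V, hV, e⟩ := exists_traceNorm_eq_trace M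
  have := h V hV
  rwa [e, Complex.norm_real, Real.norm_of_nonneg (traceNorm_nonneg _)] at this

lemma norm_trace_mul_le_traceNorm {V : Matrix m m ℂ} (hV : ‖V‖ ≤ 1) (M : Matrix m m ℂ) :
    ‖(V * M).trace‖ ≤ traceNorm M :=
  (norm_trace_mul_le V M).trans (mul_le_of_le_one_left (traceNorm_nonneg _) hV)

lemma traceNorm_add_le (M N : Matrix m m ℂ) : traceNorm (M + N) ≤ traceNorm M + traceNorm N :=
  traceNorm_le_of_forall fun V hV => by
    rw [Matrix.mul_add, Matrix.trace_add]
    exact (norm_add_le _ _).trans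
      (add_le_add (norm_trace_mul_le_traceNorm hV M) (norm_trace_mul_le_traceNorm hV N))

lemma traceNorm_smul_le (c : ℂ) (M : Matrix m m ℂ) : traceNorm (c • M) ≤ ‖c‖ * traceNorm M :=
  traceNorm_le_of_forall fun V hV => by
    rw [Matrix.mul_smul, Matrix.trace_smul, norm_smul]
    gcongr
    exact norm_trace_mul_le_traceNorm hV M

lemma traceNorm_neg (M : Matrix m m ℂ) : traceNorm (-M) = traceNorm M := by
  simp [traceNorm]

lemma traceNorm_sub_le (M N : Matrix m m ℂ) : traceNorm (M - N) ≤ traceNorm M + traceNorm N := by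
  rw [sub_eq_add_neg, ← traceNorm_neg N]
  exact traceNorm_add_le _ _

lemma traceNorm_le_card_mul_norm (M : Matrix m m ℂ) : traceNorm M ≤ Fintype.card m * ‖M‖ := by
  refine traceNorm_le_of_forall fun V hV => ?_
  rw [Matrix.trace]
  have hi : ∀ i, ‖(V * M) i i‖ ≤ ‖M‖ := fun i => by
    have h1 : ‖V * M‖ ≤ ‖M‖ :=
      (norm_mul_le _ _).trans (mul_le_of_le_one_left (norm_nonneg _) hV)
    refine le_trans ?_ h1
    have h2 := Matrix.l2_opNorm_mulVec (V * M) (EuclideanSpace.single i 1)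
    simp only [PiLp.norm_single, norm_one, mul_one] at h2
    refine le_trans ?_ h2
    refine le_of_eq_of_le ?_ (PiLp.norm_apply_le _ i)
    simp
  calc _ ≤ ∑ i, ‖(V * M) i i‖ := norm_sum_le _ _
    _ ≤ ∑ _i : m, ‖M‖ := Finset.sum_le_sum fun i _ => hi i
    _ = _ := by simp

/-- A fixed V is tested against the sum and its trace functional pulled through the integral, so
integrability of ω ↦ `traceNorm (F a ω)` itself never enters. -/
lemma traceNorm_sum_integral_le {ι : Type*} [Fintype ι] {F : ι → ℝ → Matrix m m ℂ}
    {b : ι → ℝ → ℝ} (hF : ∀ a, Integrable (F a)) (hb : ∀ a, Integrable (b a))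
    (h : ∀ a ω, traceNorm (F a ω) ≤ b a ω) :
    traceNorm (∑ a, ∫ ω, F a ω) ≤ ∑ a, ∫ ω, b a ω := by
  refine traceNorm_le_of_forall fun V hV => ?_
  rw [← traceMul_apply, map_sum]
  refine (norm_sum_le _ _).trans (Finset.sum_le_sum fun a _ => ?_)
  rw [← ContinuousLinearMap.integral_comp_comm _ (hF a)]
  refine norm_integral_le_of_norm_le (hb a) (Eventually.of_forall fun ω => ?_)
  exact (norm_trace_mul_le_traceNorm hV _).trans (h a ω)

end TraceNorm

/-! ### Perturbation of a dissipator in its jump operator. -/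

section Dissipator

variable {m : Type*} [Fintype m] [DecidableEq m]

lemma dissipator_apply (L X : Matrix m m ℂ) :
    dissipator L X = L * X * Lᴴ - (1 / 2 : ℂ) • (Lᴴ * L * X + X * (Lᴴ * L)) := rfl

lemma coherent_apply (B X : Matrix m m ℂ) :
    coherent B X = (-Complex.I) • (B * X - X * B) := rfl

/-- With E = L − L', the sandwich term changes by E X L'ᴴ + L' X Eᴴ + E X Eᴴ, contributing 2δ + δ².
The decay operator changes by G with ‖G‖ ≤ 2δ + δ², and half an anticommutator with G contributes 2δ
+ δ² again. Only the truncated jump L' has to be bounded by 1. -/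
lemma traceNorm_dissipator_sub_le {L L' : Matrix m m ℂ} {δ : ℝ} (hL' : ‖L'‖ ≤ 1)
    (hδ : ‖L - L'‖ ≤ δ) (X : Matrix m m ℂ) :
    traceNorm (dissipator L X - dissipator L' X) ≤ (4 * δ + 2 * δ ^ 2) * traceNorm X := by
  set E := L - L' with hE
  have eL : L = L' + E := by rw [hE]; abel
  have hδ0 : 0 ≤ δ := (norm_nonneg _).trans hδ
  set G := L'ᴴ * E + Eᴴ * L' + Eᴴ * E with hG
  have e : dissipator L X - dissipator L' X =
      (E * X * L'ᴴ + L' * X * Eᴴ + E * X * Eᴴ) -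
        (1 / 2 : ℂ) • (G * X * 1 + 1 * X * G) := by
    rw [dissipator_apply, dissipator_apply, eL, hG]
    simp only [Matrix.conjTranspose_add, add_mul, mul_add, Matrix.mul_one, Matrix.one_mul,
      smul_add]
    abel
  have hX := traceNorm_nonneg X
  have hL : ‖L'ᴴ‖ ≤ 1 := by rwa [Matrix.l2_opNorm_conjTranspose]
  have hE' : ‖Eᴴ‖ ≤ δ := by rwa [Matrix.l2_opNorm_conjTranspose]
  have key : ∀ {P Q : Matrix m m ℂ} {p q : ℝ}, 0 ≤ p → ‖P‖ ≤ p → ‖Q‖ ≤ q →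
      traceNorm (P * X * Q) ≤ p * q * traceNorm X := fun hp h1 h2 =>
    (traceNorm_mul_mul_le _ _ _).trans (by gcongr)
  have hG' : ‖G‖ ≤ 2 * δ + δ ^ 2 := by
    have a1 : ‖L'ᴴ * E‖ ≤ 1 * δ := (norm_mul_le _ _).trans (by gcongr)
    have a2 : ‖Eᴴ * L'‖ ≤ δ * 1 := (norm_mul_le _ _).trans (by gcongr)
    have a3 : ‖Eᴴ * E‖ ≤ δ * δ := (norm_mul_le _ _).trans (by gcongr)
    have := norm_add₃_le (a := L'ᴴ * E) (b := Eᴴ * L') (c := Eᴴ * E)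
    rw [← hG] at this
    linarith
  have h1 : ‖(1 : Matrix m m ℂ)‖ ≤ 1 := by
    rw [← Matrix.diagonal_one, Matrix.l2_opNorm_diagonal]
    exact (pi_norm_le_iff_of_nonneg zero_le_one).2 fun _ => by simp
  have b1 := key hδ0 hδ hL
  have b2 := key zero_le_one hL' hE'
  have b3 := key hδ0 hδ hE'
  have b4 := key (by positivity) hG' h1
  have b5 := key zero_le_one h1 hG'
  have c1 := traceNorm_add_le (E * X * L'ᴴ + L' * X * Eᴴ) (E * X * Eᴴ)
  have c2 := traceNorm_add_le (E * X * L'ᴴ) (L' * X * Eᴴ)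
  have c3 := traceNorm_smul_le (1 / 2 : ℂ) (G * X * 1 + 1 * X * G)
  have c4 := traceNorm_add_le (G * X * 1) (1 * X * G)
  have c5 : ‖(1 / 2 : ℂ)‖ = 1 / 2 := by norm_num
  rw [c5] at c3
  rw [e]
  refine (traceNorm_sub_le _ _).trans ?_
  linarith

end Dissipator

/-! ### Tensoring with an ancilla. -/

section Extension

variable {n : Type*} [Fintype n] [DecidableEq n]

/-- The amplification `L ↦ L ⊗ 1`. -/
noncomputable def amplify (k : ℕ) (L : Matrix n n ℂ) : Matrix (n × Fin k) (n × Fin k) ℂ :=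
  Matrix.kronecker L (1 : Matrix (Fin k) (Fin k) ℂ)

omit [DecidableEq n] in
lemma amplify_mul (k : ℕ) (L M : Matrix n n ℂ) :
    amplify k (L * M) = amplify k L * amplify k M := by
  simpa [amplify] using Matrix.mul_kronecker_mul L M (1 : Matrix (Fin k) (Fin k) ℂ) 1

omit [Fintype n] [DecidableEq n] in
lemma amplify_sub (k : ℕ) (L M : Matrix n n ℂ) :
    amplify k (L - M) = amplify k L - amplify k M := by
  ext p q
  simp [amplify, Matrix.kroneckerMap_apply, sub_mul]

omit [Fintype n] [DecidableEq n] in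
lemma amplify_conjTranspose (k : ℕ) (L : Matrix n n ℂ) : amplify k Lᴴ = (amplify k L)ᴴ := by
  simp [amplify, Matrix.conjTranspose_kronecker]

/-- A *-homomorphism of C*-algebras is contractive, so no singular values of a Kronecker product are
computed. -/
lemma norm_amplify_le (k : ℕ) (L : Matrix n n ℂ) : ‖amplify k L‖ ≤ ‖L‖ := by
  let φ : Matrix n n ℂ →⋆ₙₐ[ℂ] Matrix (n × Fin k) (n × Fin k) ℂ :=
    { toFun := amplify k
      map_smul' := fun c L => by
        ext p q
        simp [amplify, Matrix.kroneckerMap_apply, mul_assoc]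
      map_zero' := by
        ext p q
        simp [amplify, Matrix.kroneckerMap_apply]
      map_add' := fun L M => by
        ext p q
        simp [amplify, Matrix.kroneckerMap_apply, add_mul]
      map_mul' := amplify_mul k
      map_star' := amplify_conjTranspose k }
  exact NonUnitalStarAlgHom.norm_apply_le φ L

/-- The map `Φ ↦ (Φ ⊗ id) X`. -/
noncomputable def extendApply {k : ℕ} (X : Matrix (n × Fin k) (n × Fin k) ℂ) :
    (Matrix n n ℂ →L[ℂ] Matrix n n ℂ) →L[ℂ] Matrix (n × Fin k) (n × Fin k) ℂ :=
  LinearMap.toContinuousLinearMap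
    { toFun := fun Φ => extend Φ X
      map_add' := fun _ _ => rfl
      map_smul' := fun _ _ => rfl }

omit [DecidableEq n] in
lemma amplify_mul_apply {k : ℕ} (P : Matrix n n ℂ) (X : Matrix (n × Fin k) (n × Fin k) ℂ)
    (p q : n × Fin k) :
    (amplify k P * X) p q = (P * Matrix.of fun i j => X (i, p.2) (j, q.2)) p.1 q.1 := by
  simp [amplify, Matrix.mul_apply, Fintype.sum_prod_type, Matrix.kroneckerMap_apply,
    Matrix.one_apply]

omit [DecidableEq n] in
lemma mul_amplify_apply {k : ℕ} (P : Matrix n n ℂ) (X : Matrix (n × Fin k) (n × Fin k) ℂ)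
    (p q : n × Fin k) :
    (X * amplify k P) p q = ((Matrix.of fun i j => X (i, p.2) (j, q.2)) * P) p.1 q.1 := by
  simp [amplify, Matrix.mul_apply, Fintype.sum_prod_type, Matrix.kroneckerMap_apply,
    Matrix.one_apply]

/-- Reduces the diamond norm to the trace-norm estimate for one dissipator on the larger space. -/
lemma extend_dissipator {k : ℕ} (L : Matrix n n ℂ) (X : Matrix (n × Fin k) (n × Fin k) ℂ) :
    extend (dissipator L) X = dissipator (amplify k L) X := by
  ext p q
  rw [dissipator_apply, ← amplify_conjTranspose, ← amplify_mul]
  simp only [Matrix.sub_apply, Matrix.smul_apply, Matrix.add_apply, mul_amplify_apply,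
    amplify_mul_apply]
  simp only [extend, Matrix.of_apply, dissipator_apply, Matrix.sub_apply, Matrix.smul_apply,
    Matrix.add_apply]
  rfl

end Extension

/-! ### Fourier transforms of the Gaussian filter and of t times the filter. -/

section FilterIntegrals

/-- The peak value of the Fourier transform of the Gaussian filter. -/
noncomputable def filterAmp (β : ℝ) : ℝ :=
  1 / √(2 * Real.pi) * (1 / √(β * √(Real.pi / 2))) * (β * √Real.pi)

/-- The Fourier transform of the Gaussian filter. -/
noncomputable def filterHat (β ω : ℝ) : ℝ :=
  filterAmp β * Real.exp (-(β ^ 2 * ω ^ 2) / 4)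

lemma filterAmp_nonneg {β : ℝ} (hβ : 0 < β) : 0 ≤ filterAmp β := by
  unfold filterAmp; positivity

lemma filterAmp_eq {β : ℝ} (hβ : 0 < β) :
    filterAmp β = √β / (2 * Real.pi) ^ (1 / 4 : ℝ) := by
  have hpi := Real.pi_pos
  -- Both sides are nonnegative, and fourth powers remove all nested roots at once.
  refine (pow_left_inj₀ (filterAmp_nonneg hβ) (by positivity) (n := 4) (by norm_num)).1 ?_
  have h1 : √(2 * Real.pi) ^ 4 = (2 * Real.pi) ^ 2 := by
    rw [show (4 : ℕ) = 2 * 2 from rfl, pow_mul, Real.sq_sqrt (by positivity)]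
  have h2 : √(β * √(Real.pi / 2)) ^ 4 = β ^ 2 * (Real.pi / 2) := by
    rw [show (4 : ℕ) = 2 * 2 from rfl, pow_mul, Real.sq_sqrt (by positivity), mul_pow,
      Real.sq_sqrt (by positivity)]
  have h3 : √Real.pi ^ 4 = Real.pi ^ 2 := by
    rw [show (4 : ℕ) = 2 * 2 from rfl, pow_mul, Real.sq_sqrt (by positivity)]
  have h4 : √β ^ 4 = β ^ 2 := by
    rw [show (4 : ℕ) = 2 * 2 from rfl, pow_mul, Real.sq_sqrt hβ.le]
  have h5 : ((2 * Real.pi) ^ (1 / 4 : ℝ)) ^ 4 = 2 * Real.pi := by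
    rw [← Real.rpow_natCast, ← Real.rpow_mul (by positivity)]
    norm_num
  rw [filterAmp, div_pow, h4, h5, mul_pow, mul_pow, mul_pow, div_pow, div_pow, h1, h2, h3]
  field_simp

lemma ofReal_gaussianFilter (β t : ℝ) :
    (gaussianFilter β t : ℂ) =
      ((1 / √(β * √(Real.pi / 2)) : ℝ) : ℂ) * Complex.exp (-((1 / β ^ 2 : ℝ) : ℂ) * (t : ℂ) ^ 2) := by
  rw [gaussianFilter, div_eq_mul_one_div, mul_comm, Complex.ofReal_mul, Complex.ofReal_exp]
  congr 2
  push_cast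
  ring

lemma integrable_filter {β : ℝ} (hβ : 0 < β) (ω ν : ℝ) :
    Integrable fun t : ℝ => Complex.exp (-Complex.I * ω * t) * (gaussianFilter β t : ℂ) *
      Complex.exp (Complex.I * t * ν) := by
  have h := (integrable_cexp_quadratic (b := ((1 / β ^ 2 : ℝ) : ℂ))
    (by rw [Complex.ofReal_re]; positivity) (Complex.I * (ν - ω)) 0).const_mul
    ((1 / √(β * √(Real.pi / 2)) : ℝ) : ℂ)
  refine h.congr (Eventually.of_forall fun t => ?_)
  simp only []
  rw [ofReal_gaussianFilter]
  have : ∀ a b c d : ℂ, Complex.exp a * (d * Complex.exp b) * Complex.exp c =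
      d * Complex.exp (a + b + c) := fun a b c d => by
    rw [Complex.exp_add, Complex.exp_add]; ring
  rw [this]
  congr 2
  push_cast
  ring

lemma integral_filter {β : ℝ} (hβ : 0 < β) (ω ν : ℝ) :
    ((1 / √(2 * Real.pi) : ℝ) : ℂ) *
      ∫ t : ℝ, Complex.exp (-Complex.I * ω * t) * (gaussianFilter β t : ℂ) *
        Complex.exp (Complex.I * t * ν) = (filterHat β (ω - ν) : ℂ) := by
  have hb : 0 < (((1 / β ^ 2 : ℝ) : ℂ)).re := by rw [Complex.ofReal_re]; positivity
  have h := fourierIntegral_gaussian hb ((ν - ω : ℝ) : ℂ)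
  have e : ∀ t : ℝ, Complex.exp (-Complex.I * ω * t) * (gaussianFilter β t : ℂ) *
        Complex.exp (Complex.I * t * ν) = ((1 / √(β * √(Real.pi / 2)) : ℝ) : ℂ) *
      (Complex.exp (Complex.I * ((ν - ω : ℝ) : ℂ) * t) *
        Complex.exp (-((1 / β ^ 2 : ℝ) : ℂ) * (t : ℂ) ^ 2)) := fun t => by
    rw [ofReal_gaussianFilter]
    have : ∀ a b c d : ℂ, Complex.exp a * (d * Complex.exp b) * Complex.exp c =
        d * (Complex.exp (a + c) * Complex.exp b) := fun a b c d => by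
      rw [Complex.exp_add]; ring
    rw [this]
    congr 3
    push_cast
    ring
  simp_rw [e]
  rw [integral_const_mul, h]
  have h2 : ((Real.pi : ℂ) / ((1 / β ^ 2 : ℝ) : ℂ)) ^ (1 / 2 : ℂ) =
      ((β * √Real.pi : ℝ) : ℂ) := by
    have : (Real.pi : ℂ) / ((1 / β ^ 2 : ℝ) : ℂ) = ((Real.pi * β ^ 2 : ℝ) : ℂ) := by
      push_cast; field_simp
    rw [this, show (1 / 2 : ℂ) = ((1 / 2 : ℝ) : ℂ) by push_cast; rfl,
      ← Complex.ofReal_cpow (by positivity), ← Real.sqrt_eq_rpow,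
      Real.sqrt_mul Real.pi_pos.le, Real.sqrt_sq hβ.le, mul_comm]
  rw [h2, filterHat, filterAmp]
  have h3 : Complex.exp (-((ν - ω : ℝ) : ℂ) ^ 2 / (4 * ((1 / β ^ 2 : ℝ) : ℂ))) =
      ((Real.exp (-(β ^ 2 * (ω - ν) ^ 2) / 4) : ℝ) : ℂ) := by
    rw [Complex.ofReal_exp]
    congr 1
    push_cast
    field_simp
    ring
  rw [h3]
  push_cast
  ring

lemma integrable_filter_mul_id {β : ℝ} (hβ : 0 < β) (ω : ℝ) :
    Integrable fun t : ℝ => Complex.exp (-Complex.I * ω * t) * (gaussianFilter β t : ℂ) *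
      (t : ℂ) := by
  have hb : 0 < (((1 / β ^ 2 : ℝ) : ℂ)).re := by rw [Complex.ofReal_re]; positivity
  have h := (integrable_mul_cexp_neg_mul_sq hb).const_mul
    ((1 / √(β * √(Real.pi / 2)) : ℝ) : ℂ)
  refine (h.norm.mono' (f := fun t : ℝ => Complex.exp (-Complex.I * ω * t) *
    (gaussianFilter β t : ℂ) * (t : ℂ)) ?_ ?_)
  · refine Continuous.aestronglyMeasurable ?_
    unfold gaussianFilter
    fun_prop
  · refine Eventually.of_forall fun t => le_of_eq ?_
    rw [ofReal_gaussianFilter]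
    have : -Complex.I * ω * t = ((-(ω * t) : ℝ) : ℂ) * Complex.I := by push_cast; ring
    rw [this]
    simp only [norm_mul, Complex.norm_exp_ofReal_mul_I]
    ring

/-- The Fourier integrand g satisfies g' = −iω g − (2/β²) t g. Since g' has integral zero, ∫ t g =
−(iβ²ω/2) ∫ g. -/
lemma integral_filter_mul_id {β : ℝ} (hβ : 0 < β) (ω : ℝ) :
    ((1 / √(2 * Real.pi) : ℝ) : ℂ) *
      ∫ t : ℝ, Complex.exp (-Complex.I * ω * t) * (gaussianFilter β t : ℂ) * (t : ℂ) =
        -(Complex.I * (β ^ 2 * ω / 2) * (filterHat β ω : ℂ)) := by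
  obtain ⟨g, hg⟩ : ∃ g : ℝ → ℂ, g = fun t : ℝ =>
      Complex.exp (-Complex.I * ω * t) * (gaussianFilter β t : ℂ) := ⟨_, rfl⟩
  have hβ2 : (β : ℂ) ≠ 0 := by exact_mod_cast hβ.ne'
  have hgi : Integrable g := by simpa [hg] using integrable_filter hβ ω 0
  have hti : Integrable fun t => g t * (t : ℂ) := by
    simpa only [hg] using integrable_filter_mul_id hβ ω
  have hd : ∀ t : ℝ, HasDerivAt g
      (-(Complex.I * ω) * g t + -(2 / β ^ 2 : ℂ) * (g t * (t : ℂ))) t := fun t => by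
    have h1 : HasDerivAt (fun z : ℂ => Complex.exp (-Complex.I * ω * z) *
        (((1 / √(β * √(Real.pi / 2)) : ℝ) : ℂ) *
          Complex.exp (-((1 / β ^ 2 : ℝ) : ℂ) * z ^ 2)))
        (-(Complex.I * ω) * g t + -(2 / β ^ 2 : ℂ) * (g t * (t : ℂ))) (t : ℂ) := by
      have a1 : HasDerivAt (fun z : ℂ => Complex.exp (-Complex.I * ω * z))
          (Complex.exp (-Complex.I * ω * t) * (-Complex.I * ω * 1)) (t : ℂ) :=
        ((hasDerivAt_id (t : ℂ)).const_mul _).cexp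
      have a2 : HasDerivAt (fun z : ℂ => Complex.exp (-((1 / β ^ 2 : ℝ) : ℂ) * z ^ 2))
          (Complex.exp (-((1 / β ^ 2 : ℝ) : ℂ) * (t : ℂ) ^ 2) *
            (-((1 / β ^ 2 : ℝ) : ℂ) * ((2 : ℕ) * (t : ℂ) ^ (2 - 1)))) (t : ℂ) :=
        ((hasDerivAt_pow 2 (t : ℂ)).const_mul _).cexp
      refine (a1.mul (a2.const_mul ((1 / √(β * √(Real.pi / 2)) : ℝ) : ℂ))).congr_deriv ?_
      rw [hg]
      simp only []
      rw [ofReal_gaussianFilter]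
      push_cast
      ring
    refine h1.comp_ofReal.congr_of_eventuallyEq (Eventually.of_forall fun s => ?_)
    simp only [hg]
    rw [ofReal_gaussianFilter]
  have h0 := integral_eq_zero_of_hasDerivAt_of_integrable hd
    ((hgi.const_mul _).add (hti.const_mul _)) hgi
  rw [integral_add (hgi.const_mul _) (hti.const_mul _), integral_const_mul,
    integral_const_mul] at h0
  have h1 := integral_filter hβ ω 0
  simp only [Complex.ofReal_zero, mul_zero, Complex.exp_zero, mul_one, sub_zero] at h1
  have e1 : ∫ t : ℝ, Complex.exp (-Complex.I * ω * t) * (gaussianFilter β t : ℂ) = ∫ t, g t := by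
    rw [hg]
  have e2 : ∫ t : ℝ, Complex.exp (-Complex.I * ω * t) * (gaussianFilter β t : ℂ) * (t : ℂ) =
      ∫ t, g t * (t : ℂ) := by rw [hg]
  rw [← h1, e1, e2]
  have h2 : ∫ t, g t * (t : ℂ) = -(Complex.I * (β ^ 2 * ω / 2)) * ∫ t, g t := by
    have := congrArg (fun z => (β : ℂ) ^ 2 / 2 * z) h0
    field_simp at this ⊢
    linear_combination -this
  rw [h2]
  ring

end FilterIntegrals

/-! ### Jump operators in the eigenbasis of the Hamiltonian. -/

section Eigenbasis

variable {n : Type*} [Fintype n] [DecidableEq n] {H : Matrix n n ℂ} (hH : H.IsHermitian)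

/-- Passage from the eigenbasis of a Hermitian matrix to the standard basis. -/
noncomputable def ofEigenbasis : Matrix n n ℂ ≃⋆ₐ[ℂ] Matrix n n ℂ :=
  Unitary.conjStarAlgAut ℂ (Matrix n n ℂ) hH.eigenvectorUnitary

lemma ofEigenbasis_apply (X : Matrix n n ℂ) : ofEigenbasis hH X =
    (hH.eigenvectorUnitary : Matrix n n ℂ) * X * (hH.eigenvectorUnitary : Matrix n n ℂ)ᴴ := rfl

lemma ofEigenbasis_symm_apply (X : Matrix n n ℂ) : (ofEigenbasis hH).symm X =
    (hH.eigenvectorUnitary : Matrix n n ℂ)ᴴ * X * (hH.eigenvectorUnitary : Matrix n n ℂ) := by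
  rw [ofEigenbasis, Unitary.conjStarAlgAut_symm_apply]
  rfl

lemma ofEigenbasis_diagonal :
    ofEigenbasis hH (Matrix.diagonal fun i => (hH.eigenvalues i : ℂ)) = H :=
  (eq_eigenvectorUnitary_conj hH).symm

lemma norm_ofEigenbasis (X : Matrix n n ℂ) : ‖ofEigenbasis hH X‖ = ‖X‖ :=
  norm_conj_eq_of_star_mul_self (eigenvectorUnitary_star_mul hH) (eigenvectorUnitary_mul_star hH) X

lemma norm_ofEigenbasis_symm (X : Matrix n n ℂ) : ‖(ofEigenbasis hH).symm X‖ = ‖X‖ := by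
  rw [← norm_ofEigenbasis hH, StarAlgEquiv.apply_symm_apply]

/-- `ofEigenbasis` as a continuous linear map. -/
noncomputable def ofEigenbasisCLM : Matrix n n ℂ →L[ℂ] Matrix n n ℂ :=
  LinearMap.toContinuousLinearMap
    { toFun := ofEigenbasis hH, map_add' := map_add _, map_smul' := fun c X => map_smul _ c X }

lemma ofEigenbasisCLM_apply (X : Matrix n n ℂ) : ofEigenbasisCLM hH X = ofEigenbasis hH X := rfl

lemma ofEigenbasis_conjTranspose (X : Matrix n n ℂ) :
    ofEigenbasis hH Xᴴ = (ofEigenbasis hH X)ᴴ := map_star (ofEigenbasis hH) X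

lemma ofEigenbasis_dissipator (L X : Matrix n n ℂ) :
    dissipator (ofEigenbasis hH L) (ofEigenbasis hH X) = ofEigenbasis hH (dissipator L X) := by
  rw [dissipator_apply, dissipator_apply]
  simp only [map_sub, map_smul, map_add, map_mul, ofEigenbasis_conjTranspose]

lemma exp_smul_eq (z : ℂ) : NormedSpace.exp (z • H) =
    ofEigenbasis hH (Matrix.diagonal fun i => Complex.exp (z * hH.eigenvalues i)) := by
  have h1 : z • H = ofEigenbasis hH (Matrix.diagonal fun i => z * (hH.eigenvalues i : ℂ)) := by
    conv_lhs => rw [← ofEigenbasis_diagonal hH]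
    rw [← map_smul, ← Matrix.diagonal_smul]
    rfl
  let +nondep : NormedAlgebra ℚ (Matrix n n ℂ) := .restrictScalars ℚ ℂ _
  have h2 := NormedSpace.map_exp (ofEigenbasis hH) (ofEigenbasisCLM hH).continuous
    (Matrix.diagonal fun i => z * (hH.eigenvalues i : ℂ))
  rw [h1, ← h2, Matrix.exp_diagonal]
  congr 2
  ext i
  rw [Pi.coe_exp, Complex.exp_eq_exp_ℂ]

lemma matrix_eq_sum_single (X : Matrix n n ℂ) :
    X = ∑ i, ∑ j, X i j • Matrix.single i j (1 : ℂ) := by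
  conv_lhs => rw [Matrix.matrix_eq_sum_single X]
  refine Finset.sum_congr rfl fun i _ => Finset.sum_congr rfl fun j _ => ?_
  rw [Matrix.smul_single, smul_eq_mul, mul_one]

lemma norm_single_one_le (i j : n) : ‖(Matrix.single i j (1 : ℂ) : Matrix n n ℂ)‖ ≤ 1 := by
  have h := Matrix.l2_opNorm_conjTranspose_mul_self (Matrix.single i j (1 : ℂ) : Matrix n n ℂ)
  rw [Matrix.conjTranspose_single, Matrix.single_mul_single_same, ← Matrix.diagonal_single,
    Matrix.l2_opNorm_diagonal, star_one, one_mul, Pi.norm_single, norm_one] at h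
  nlinarith [norm_nonneg (Matrix.single i j (1 : ℂ) : Matrix n n ℂ)]

/-- A crude, dimension-dependent bound, used for boundedness in ω and smallness as β → 0 but not for
the jump error. -/
lemma norm_le_sum_norm_apply (X : Matrix n n ℂ) : ‖X‖ ≤ ∑ i, ∑ j, ‖X i j‖ := by
  conv_lhs => rw [matrix_eq_sum_single X]
  refine (norm_sum_le _ _).trans (Finset.sum_le_sum fun i _ => ?_)
  refine (norm_sum_le _ _).trans (Finset.sum_le_sum fun j _ => ?_)
  rw [norm_smul]
  exact mul_le_of_le_one_right (norm_nonneg _) (norm_single_one_le i j)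

lemma integrable_matrix {F : ℝ → n → n → ℂ} (hF : ∀ i j, Integrable fun t => F t i j) :
    Integrable fun t => (Matrix.of (F t) : Matrix n n ℂ) := by
  have : (fun t => (Matrix.of (F t) : Matrix n n ℂ)) =
      fun t => ∑ i, ∑ j, F t i j • (Matrix.single i j (1 : ℂ) : Matrix n n ℂ) := by
    ext1 t
    exact matrix_eq_sum_single _
  rw [this]
  exact integrable_finsetSum _ fun i _ => integrable_finsetSum _ fun j _ =>
    (hF i j).smul_const _

/-- Evaluation of a matrix entry as a continuous linear map. -/
noncomputable def entryCLM (i j : n) : Matrix n n ℂ →L[ℂ] ℂ :=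
  LinearMap.toContinuousLinearMap (Matrix.entryLinearMap ℂ ℂ i j)

lemma integral_matrix_apply {F : ℝ → Matrix n n ℂ} (hF : Integrable F) (i j : n) :
    (∫ t, F t) i j = ∫ t, F t i j :=
  ((entryCLM i j).integral_comp_comm hF).symm

lemma filteredTransform_ofEigenbasis {β : ℝ} {M : ℝ → Matrix n n ℂ} {F : ℝ → n → n → ℂ} {ω : ℝ}
    (hM : ∀ t, M t = ofEigenbasis hH (Matrix.of (F t)))
    (hF : ∀ i j, Integrable fun t : ℝ =>
      Complex.exp (-Complex.I * ω * t) * (gaussianFilter β t : ℂ) * F t i j) :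
    filteredTransform β M ω = ofEigenbasis hH (Matrix.of fun i j =>
      ((1 / √(2 * Real.pi) : ℝ) : ℂ) * ∫ t : ℝ,
        Complex.exp (-Complex.I * ω * t) * (gaussianFilter β t : ℂ) * F t i j) := by
  have hI := integrable_matrix (F := fun t i j =>
    Complex.exp (-Complex.I * ω * t) * (gaussianFilter β t : ℂ) * F t i j) hF
  have e : ∀ t : ℝ, (Complex.exp (-Complex.I * ω * t) * (gaussianFilter β t : ℂ)) • M t =
      ofEigenbasisCLM hH (Matrix.of fun i j =>
        Complex.exp (-Complex.I * ω * t) * (gaussianFilter β t : ℂ) * F t i j) := fun t => by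
    rw [hM, ← ofEigenbasisCLM_apply, ← map_smul]
    rfl
  rw [filteredTransform]
  simp_rw [e]
  rw [ContinuousLinearMap.integral_comp_comm _ hI, ← map_smul, ofEigenbasisCLM_apply]
  congr 1
  ext i j
  rw [Matrix.smul_apply, integral_matrix_apply hI]
  rfl

/-- Conjugation by e^{iHt} multiplies the (i, j) entry by the phase e^{it(Eᵢ − Eⱼ)}, which shifts
the frequency of the filter. -/
lemma jump_eq {β : ℝ} (hβ : 0 < β) (A : Matrix n n ℂ) (ω : ℝ) :
    jump H A β ω = ofEigenbasis hH (Matrix.of fun i j =>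
      (filterHat β (ω - (hH.eigenvalues i - hH.eigenvalues j)) : ℂ) *
        (ofEigenbasis hH).symm A i j) := by
  set A' := (ofEigenbasis hH).symm A with hA'
  have hA : A = ofEigenbasis hH A' := by rw [hA', StarAlgEquiv.apply_symm_apply]
  have e : ∀ (t : ℝ) (i j : n), Complex.exp (-Complex.I * ω * t) * (gaussianFilter β t : ℂ) *
      (Complex.exp (Complex.I * t * ((hH.eigenvalues i - hH.eigenvalues j : ℝ) : ℂ)) * A' i j) =
      (Complex.exp (-Complex.I * ω * t) * (gaussianFilter β t : ℂ) *
        Complex.exp (Complex.I * t * ((hH.eigenvalues i - hH.eigenvalues j : ℝ) : ℂ))) * A' i j :=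
    fun t i j => by ring
  rw [jump, filteredTransform_ofEigenbasis hH (F := fun t i j =>
    Complex.exp (Complex.I * t * ((hH.eigenvalues i - hH.eigenvalues j : ℝ) : ℂ)) * A' i j)]
  · congr 1
    ext i j
    simp only [Matrix.of_apply]
    simp_rw [e]
    rw [integral_mul_const, ← mul_assoc, integral_filter hβ]
  · intro t
    rw [exp_smul_eq hH, exp_smul_eq hH, hA, ← map_mul, ← map_mul]
    congr 1
    ext i j
    rw [Matrix.mul_diagonal, Matrix.diagonal_mul, Matrix.of_apply, mul_right_comm,
      ← Complex.exp_add]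
    congr 2
    push_cast
    ring
  · intro i j
    simp_rw [e]
    exact (integrable_filter hβ ω _).mul_const _

/-- The factor is the first-order Taylor polynomial in ν of the factor f̂(ω − ν) of `jump_eq`. -/
lemma truncatedJump_eq {β : ℝ} (hβ : 0 < β) (A : Matrix n n ℂ) (ω : ℝ) :
    truncatedJump H A β ω = ofEigenbasis hH (Matrix.of fun i j =>
      ((filterHat β ω * (1 + β ^ 2 * ω / 2 * (hH.eigenvalues i - hH.eigenvalues j)) : ℝ) : ℂ) *
        (ofEigenbasis hH).symm A i j) := by
  set A' := (ofEigenbasis hH).symm A with hA'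
  have hA : A = ofEigenbasis hH A' := by rw [hA', StarAlgEquiv.apply_symm_apply]
  have e : ∀ (t : ℝ) (i j : n), Complex.exp (-Complex.I * ω * t) * (gaussianFilter β t : ℂ) *
      (A' i j + t * (Complex.I * ((hH.eigenvalues i - hH.eigenvalues j : ℝ) : ℂ) * A' i j)) =
      (Complex.exp (-Complex.I * ω * t) * (gaussianFilter β t : ℂ) *
        Complex.exp (Complex.I * t * ((0 : ℝ) : ℂ))) * A' i j +
      (Complex.exp (-Complex.I * ω * t) * (gaussianFilter β t : ℂ) * (t : ℂ)) *
        (Complex.I * ((hH.eigenvalues i - hH.eigenvalues j : ℝ) : ℂ) * A' i j) :=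
    fun t i j => by
      rw [Complex.ofReal_zero, mul_zero, Complex.exp_zero]
      ring
  have i1 := fun i j => (integrable_filter hβ ω 0).mul_const (A' i j)
  have i2 := fun i j => (integrable_filter_mul_id hβ ω).mul_const
    (Complex.I * ((hH.eigenvalues i - hH.eigenvalues j : ℝ) : ℂ) * A' i j)
  rw [truncatedJump, filteredTransform_ofEigenbasis hH (F := fun t i j =>
    A' i j + t * (Complex.I * ((hH.eigenvalues i - hH.eigenvalues j : ℝ) : ℂ) * A' i j))]
  · congr 1
    ext i j
    simp only [Matrix.of_apply]
    simp_rw [e]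
    rw [integral_add (i1 i j) (i2 i j), integral_mul_const, integral_mul_const, mul_add,
      ← mul_assoc, ← mul_assoc, integral_filter hβ, integral_filter_mul_id hβ, sub_zero]
    push_cast
    linear_combination (-(filterHat β ω : ℂ) * (β ^ 2 * ω / 2) *
      (hH.eigenvalues i - hH.eigenvalues j) * A' i j) * Complex.I_mul_I
  · intro t
    have hD : H = ofEigenbasis hH (Matrix.diagonal fun i => (hH.eigenvalues i : ℂ)) :=
      (ofEigenbasis_diagonal hH).symm
    have : A + (t : ℂ) • ((Complex.I • H) * A - A * (Complex.I • H)) =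
        ofEigenbasis hH (A' + (t : ℂ) •
          ((Complex.I • Matrix.diagonal fun i => (hH.eigenvalues i : ℂ)) * A' -
            A' * (Complex.I • Matrix.diagonal fun i => (hH.eigenvalues i : ℂ)))) := by
      simp only [map_add, map_smul, map_sub, map_mul, ofEigenbasis_diagonal, ← hA]
    rw [this]
    congr 1
    ext i j
    simp only [Matrix.add_apply, Matrix.smul_apply, Matrix.sub_apply, Matrix.smul_mul,
      Matrix.mul_smul, Matrix.diagonal_mul, Matrix.mul_diagonal, Matrix.of_apply, smul_eq_mul]
    push_cast
    ring
  · intro i j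
    simp_rw [e]
    exact (i1 i j).add (i2 i j)

end Eigenbasis

/-! ### The scalar inequality for the Hermite tail. -/

section ScalarBound

lemma nonneg_of_deriv_nonneg {f f' : ℝ → ℝ} (hf : ∀ x, HasDerivAt f (f' x) x) (h0 : f 0 = 0)
    (h : ∀ x, 0 ≤ x → 0 ≤ f' x) {x : ℝ} (hx : 0 ≤ x) : 0 ≤ f x := by
  have hm : MonotoneOn f (Set.Ici 0) := by
    refine monotoneOn_of_deriv_nonneg (convex_Ici 0)
      (fun x _ => (hf x).continuousAt.continuousWithinAt)
      (fun x _ => (hf x).differentiableAt.differentiableWithinAt) fun x hx => ?_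
    rw [interior_Ici] at hx
    rw [(hf x).deriv]
    exact h x (le_of_lt hx)
  rw [← h0]
  exact hm (Set.mem_Ici.2 le_rfl) (Set.mem_Ici.2 hx) hx

lemma hasDerivAt_polynomial_mul_exp_add (a b c d e f g x : ℝ) :
    HasDerivAt (fun x => (a * x ^ 2 + b * x + c) * Real.exp x + (d * x ^ 3 + e * x ^ 2 + f * x + g))
      ((a * x ^ 2 + (2 * a + b) * x + (b + c)) * Real.exp x + (3 * d * x ^ 2 + 2 * e * x + f)) x := by
  have h1 : HasDerivAt (fun x : ℝ => a * x ^ 2 + b * x + c) (a * (2 * x) + b) x := by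
    simpa using ((((hasDerivAt_id x).pow 2).const_mul a).add
      ((hasDerivAt_id x).const_mul b)).add_const c
  have h2 : HasDerivAt (fun x : ℝ => d * x ^ 3 + e * x ^ 2 + f * x + g)
      (d * (3 * x ^ 2) + e * (2 * x) + f) x := by
    simpa using (((((hasDerivAt_id x).pow 3).const_mul d).add
      (((hasDerivAt_id x).pow 2).const_mul e)).add ((hasDerivAt_id x).const_mul f)).add_const g
  exact ((h1.mul (Real.hasDerivAt_exp x)).add h2).congr_deriv (by ring)

/-- Coefficientwise, 1/k! ≤ 1/(12 (k−2)!) for k ≥ 4, because k(k−1) ≥ 12, and the extra y³/12 gives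
equality at k = 3. The proof differentiates down to (x² + 8x)eˣ ≥ 0; every function in the chain
vanishes at 0. -/
lemma exp_third_remainder_le {y : ℝ} (hy : 0 ≤ y) :
    Real.exp y - 1 - y - y ^ 2 / 2 ≤ y ^ 3 / 12 + y ^ 2 / 12 * (Real.exp y - 1) := by
  have h3 : ∀ x : ℝ, 0 ≤ x → 0 ≤ (1 * x ^ 2 + 6 * x + -6) * Real.exp x +
      (0 * x ^ 3 + 0 * x ^ 2 + 0 * x + 6) := fun x hx =>
    nonneg_of_deriv_nonneg (hasDerivAt_polynomial_mul_exp_add 1 6 (-6) 0 0 0 6) (by norm_num)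
      (fun x hx => by
        have : (1 * x ^ 2 + (2 * 1 + 6) * x + (6 + -6)) * Real.exp x +
          (3 * 0 * x ^ 2 + 2 * 0 * x + 0) = (x ^ 2 + 8 * x) * Real.exp x := by ring
        rw [this]; positivity) hx
  have h2 : ∀ x : ℝ, 0 ≤ x → 0 ≤ (1 * x ^ 2 + 4 * x + -10) * Real.exp x +
      (0 * x ^ 3 + 0 * x ^ 2 + 6 * x + 10) := fun x hx =>
    nonneg_of_deriv_nonneg (hasDerivAt_polynomial_mul_exp_add 1 4 (-10) 0 0 6 10) (by norm_num)
      (fun x hx => by have := h3 x hx; ring_nf at this ⊢; linarith) hx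
  have h1 : ∀ x : ℝ, 0 ≤ x → 0 ≤ (1 * x ^ 2 + 2 * x + -12) * Real.exp x +
      (0 * x ^ 3 + 3 * x ^ 2 + 10 * x + 12) := fun x hx =>
    nonneg_of_deriv_nonneg (hasDerivAt_polynomial_mul_exp_add 1 2 (-12) 0 3 10 12) (by norm_num)
      (fun x hx => by have := h2 x hx; ring_nf at this ⊢; linarith) hx
  have h0 : 0 ≤ (1 * y ^ 2 + 0 * y + -12) * Real.exp y +
      (1 * y ^ 3 + 5 * y ^ 2 + 12 * y + 12) :=
    nonneg_of_deriv_nonneg (hasDerivAt_polynomial_mul_exp_add 1 0 (-12) 1 5 12 12) (by norm_num)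
      (fun x hx => by have := h1 x hx; ring_nf at this ⊢; linarith) hy
  linarith

/-- This is the polynomial part of the Hermite tail after division by s². The negative square comes
from the −1 in `exp_third_remainder_le`. -/
lemma quartic_le_exp {x s : ℝ} (hx : 0 ≤ x) (hs : 0 ≤ s) :
    |2 * x ^ 2 - 1| + 2 * x * s + s ^ 2 / 2 + s * (2 * x + s) ^ 3 / 12 - (2 * x + s) ^ 2 / 12 ≤
      1.24 * Real.exp (x ^ 2 / 2 + 5 * s ^ 2) := by
  have hxs := mul_nonneg hx hs
  -- With w = x²/2 + 5s², the quadratic lower bound for exp(w) is expanded at 0 when w ≤ 1 and at 1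
  -- when w ≥ 1.
  rcases le_total (x ^ 2 / 2 + 5 * s ^ 2) 1 with hw | hw
  · refine le_trans ?_ (mul_le_mul_of_nonneg_left
      (Real.quadratic_le_exp_of_nonneg (x := x ^ 2 / 2 + 5 * s ^ 2) (by positivity))
      (by norm_num))
    rcases abs_cases (2 * x ^ 2 - 1) with ⟨h, -⟩ | ⟨h, -⟩ <;> rw [h] <;>
    nlinarith [sq_nonneg (x ^ 2 - 2), sq_nonneg (x ^ 2 - 2 - x * s), sq_nonneg (x - 6 * s),
      sq_nonneg (x * (x - 5 * s)), sq_nonneg (x * s), sq_nonneg (s ^ 2),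
      mul_nonneg hxs (sub_nonneg.2 hw)]
  · have h1 : 2.718 * (1 + (x ^ 2 / 2 + 5 * s ^ 2 - 1) + (x ^ 2 / 2 + 5 * s ^ 2 - 1) ^ 2 / 2) ≤
        Real.exp (x ^ 2 / 2 + 5 * s ^ 2) := by
      have e : Real.exp (x ^ 2 / 2 + 5 * s ^ 2) =
          Real.exp 1 * Real.exp (x ^ 2 / 2 + 5 * s ^ 2 - 1) := by
        rw [← Real.exp_add]; congr 1; ring
      rw [e]
      refine mul_le_mul (by linarith [Real.exp_one_gt_d9])
        (Real.quadratic_le_exp_of_nonneg (sub_nonneg.2 hw)) ?_ (Real.exp_nonneg _)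
      have := sub_nonneg.2 hw
      positivity
    refine le_trans ?_ (mul_le_mul_of_nonneg_left h1 (by norm_num))
    rcases abs_cases (2 * x ^ 2 - 1) with ⟨h, -⟩ | ⟨h, -⟩ <;> rw [h] <;>
    nlinarith [sq_nonneg (x ^ 2 - 2), sq_nonneg (x ^ 2 - 2 - x * s), sq_nonneg (x - 6 * s),
      sq_nonneg (x * (x - 5 * s)), sq_nonneg (x * s), sq_nonneg (s ^ 2)]

/-- Weighted AM–GM, 2xs ≤ 2x²/7 + 7s²/2, moves the cross term into the Gaussian. The exponent w left
over absorbs the quadratic prefactor through e·w ≤ exp(w). -/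
lemma sq_mul_exp_le (x s : ℝ) :
    (2 * x + s) ^ 2 / 12 * Real.exp (2 * x * s + s ^ 2) ≤
      0.64 * Real.exp (x ^ 2 / 2 + 5 * s ^ 2) := by
  set w := 3 * x ^ 2 / 14 + s ^ 2 / 2 with hw
  have h1 : Real.exp (2 * x * s + s ^ 2) ≤ Real.exp (2 * x ^ 2 / 7 + 9 * s ^ 2 / 2) :=
    Real.exp_le_exp.2 (by nlinarith [sq_nonneg (2 * x - 7 * s)])
  have h2 : Real.exp (x ^ 2 / 2 + 5 * s ^ 2) =
      Real.exp w * Real.exp (2 * x ^ 2 / 7 + 9 * s ^ 2 / 2) := by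
    rw [← Real.exp_add]; congr 1; rw [hw]; ring
  have h3 : 2.718 * w ≤ Real.exp w := by
    have e : Real.exp w = Real.exp 1 * Real.exp (w - 1) := by rw [← Real.exp_add]; congr 1; ring
    have h4 := Real.add_one_le_exp (w - 1)
    have h5 := Real.exp_one_gt_d9
    have h6 : 0 ≤ w := by rw [hw]; positivity
    rw [e]
    nlinarith
  have h7 : (2 * x + s) ^ 2 / 12 ≤ 0.64 * Real.exp w := by
    have : (2 * x + s) ^ 2 / 12 ≤ 0.64 * (2.718 * w) := by
      rw [hw]; nlinarith [sq_nonneg (x - 4.3 * s), sq_nonneg s]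
    linarith
  rw [h2, ← mul_assoc]
  exact mul_le_mul h7 h1 (Real.exp_nonneg _) (by positivity)

/-- The sum of the moduli of the terms of order at least two in the generating function
`exp (2 x s - s²)` of the Hermite polynomials is bounded by a Gaussian. -/
lemma hermite_tail_le {x s : ℝ} (hx : 0 ≤ x) (hs : 0 ≤ s) :
    |2 * x ^ 2 - 1| * s ^ 2 + 2 * x * s ^ 3 + s ^ 4 / 2 +
      (Real.exp (2 * x * s + s ^ 2) - 1 - (2 * x * s + s ^ 2) - (2 * x * s + s ^ 2) ^ 2 / 2) ≤
      1.88 * s ^ 2 * Real.exp (x ^ 2 / 2 + 5 * s ^ 2) := by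
  have h1 := exp_third_remainder_le (y := 2 * x * s + s ^ 2) (by positivity)
  have h2 := sq_mul_exp_le x s
  have h3 := quartic_le_exp hx hs
  -- The constant is 1.88 = 1.24 + 0.64, from the polynomial and the exponential part.
  have h5 : |2 * x ^ 2 - 1| + 2 * x * s + s ^ 2 / 2 + s * (2 * x + s) ^ 3 / 12 -
      (2 * x + s) ^ 2 / 12 + (2 * x + s) ^ 2 / 12 * Real.exp (2 * x * s + s ^ 2) ≤
      1.88 * Real.exp (x ^ 2 / 2 + 5 * s ^ 2) := by linarith
  have h6 := mul_le_mul_of_nonneg_left h5 (sq_nonneg s)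
  have e : (2 * x * s + s ^ 2) ^ 3 / 12 + (2 * x * s + s ^ 2) ^ 2 / 12 *
      (Real.exp (2 * x * s + s ^ 2) - 1) = s ^ 2 * (s * (2 * x + s) ^ 3 / 12 -
      (2 * x + s) ^ 2 / 12 + (2 * x + s) ^ 2 / 12 * Real.exp (2 * x * s + s ^ 2)) := by ring
  rw [e] at h1
  linarith

end ScalarBound

/-! ### The Hermite tail in a Banach algebra. -/

section OperatorBound

variable {𝔸 : Type*} [NormedRing 𝔸] [NormedAlgebra ℂ 𝔸] [CompleteSpace 𝔸]

omit [CompleteSpace 𝔸] in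
lemma ringHom_map_exp {𝔹 : Type*} [NormedRing 𝔹] [NormedAlgebra ℂ 𝔹] (f : 𝔹 →+* 𝔸)
    (hf : Continuous f) [CompleteSpace 𝔹] (x : 𝔹) :
    f (NormedSpace.exp x) = NormedSpace.exp (f x) := by
  let +nondep : NormedAlgebra ℚ 𝔹 := .restrictScalars ℚ ℂ _
  let +nondep : NormedAlgebra ℚ 𝔸 := .restrictScalars ℚ ℂ _
  exact NormedSpace.map_exp f hf x

/-- The exponential series from degree three on is dominated term by term by its scalar counterpart
at r. -/
lemma norm_exp_third_remainder_le {Y : 𝔸} {r : ℝ} (hY : ‖Y‖ ≤ r) :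
    ‖NormedSpace.exp Y - 1 - Y - (1 / 2 : ℂ) • Y ^ 2‖ ≤ Real.exp r - 1 - r - r ^ 2 / 2 := by
  have h1 := (hasSum_nat_add_iff' 3).2 (NormedSpace.exp_series_hasSum_exp' (𝕂 := ℂ) Y)
  have h2 := (hasSum_nat_add_iff' 3).2 (NormedSpace.exp_series_hasSum_exp' (𝕂 := ℝ) r)
  have e1 : NormedSpace.exp Y - ∑ i ∈ Finset.range 3, ((i.factorial : ℂ))⁻¹ • Y ^ i =
      NormedSpace.exp Y - 1 - Y - (1 / 2 : ℂ) • Y ^ 2 := by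
    simp [Finset.sum_range_succ]
    abel
  have e2 : NormedSpace.exp r - ∑ i ∈ Finset.range 3, ((i.factorial : ℝ))⁻¹ • r ^ i =
      Real.exp r - 1 - r - r ^ 2 / 2 := by
    rw [Real.exp_eq_exp_ℝ]
    simp [Finset.sum_range_succ]
    ring
  rw [e1] at h1
  rw [e2] at h2
  refine h1.norm_le_of_bounded h2 fun k => ?_
  rw [norm_smul, smul_eq_mul]
  have h3 : ‖Y ^ (k + 3)‖ ≤ r ^ (k + 3) :=
    (norm_pow_le' Y (by omega)).trans (by gcongr)
  have h4 : ‖(((k + 3).factorial : ℂ))⁻¹‖ = (((k + 3).factorial : ℝ))⁻¹ := by simp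
  rw [h4]
  gcongr

lemma norm_exp_hermite_remainder_le {S : 𝔸} {s : ℝ} (hS : ‖S‖ ≤ s) (x : ℝ) :
    ‖NormedSpace.exp ((2 * x : ℂ) • S - S ^ 2) - 1 - (2 * x : ℂ) • S‖ ≤
      1.88 * s ^ 2 * Real.exp (x ^ 2 / 2 + 5 * s ^ 2) := by
  have hs : 0 ≤ s := (norm_nonneg _).trans hS
  -- Positive exponents only, since the algebra is not assumed to have ‖1‖ = 1.
  have hp : ∀ k : ℕ, 0 < k → ‖S ^ k‖ ≤ s ^ k := fun k hk =>
    (norm_pow_le' S hk).trans (by gcongr)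
  have hx2 : ‖(2 * x : ℂ)‖ = 2 * |x| := by simp
  set Y := (2 * x : ℂ) • S - S ^ 2 with hYd
  have hY : ‖Y‖ ≤ 2 * |x| * s + s ^ 2 := by
    refine (norm_sub_le _ _).trans (add_le_add ?_ (hp 2 (by norm_num)))
    rw [norm_smul, hx2]
    gcongr
  have hY2 : Y ^ 2 = (4 * x ^ 2 : ℂ) • S ^ 2 - (4 * x : ℂ) • S ^ 3 + S ^ 4 := by
    rw [hYd]
    simp only [pow_succ, pow_zero, one_mul, sub_mul, mul_sub, smul_mul_assoc, mul_smul_comm,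
      ← mul_assoc]
    module
  -- Expanding Y + Y²/2 explicitly, rather than bounding it by ‖Y‖, preserves the cancellation in
  -- the coefficient 2x² − 1 of S².
  have e : NormedSpace.exp Y - 1 - (2 * x : ℂ) • S =
      (NormedSpace.exp Y - 1 - Y - (1 / 2 : ℂ) • Y ^ 2) +
        (((2 * x ^ 2 - 1 : ℝ) : ℂ) • S ^ 2 - (2 * x : ℂ) • S ^ 3 + (1 / 2 : ℂ) • S ^ 4) := by
    rw [hY2]
    have : Y = (2 * x : ℂ) • S - S ^ 2 := hYd
    generalize NormedSpace.exp Y = Z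
    rw [this]
    push_cast
    module
  have b1 := norm_exp_third_remainder_le hY
  have b2 : ‖((2 * x ^ 2 - 1 : ℝ) : ℂ) • S ^ 2‖ ≤ |2 * x ^ 2 - 1| * s ^ 2 := by
    rw [norm_smul, Complex.norm_real, Real.norm_eq_abs]
    gcongr
    exact hp 2 (by norm_num)
  have b3 : ‖(2 * x : ℂ) • S ^ 3‖ ≤ 2 * |x| * s ^ 3 := by
    rw [norm_smul, hx2]
    gcongr
    exact hp 3 (by norm_num)
  have b4 : ‖(1 / 2 : ℂ) • S ^ 4‖ ≤ s ^ 4 / 2 := by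
    rw [norm_smul]
    have := hp 4 (by norm_num)
    norm_num
    linarith
  have b5 := hermite_tail_le (abs_nonneg x) hs
  rw [sq_abs] at b5
  rw [e]
  refine (norm_add_le _ _).trans ?_
  have b6 := norm_add_le (((2 * x ^ 2 - 1 : ℝ) : ℂ) • S ^ 2 - (2 * x : ℂ) • S ^ 3)
    ((1 / 2 : ℂ) • S ^ 4)
  have b7 := norm_sub_le (((2 * x ^ 2 - 1 : ℝ) : ℂ) • S ^ 2) ((2 * x : ℂ) • S ^ 3)
  linarith

end OperatorBound

/-! ### The truncation error of a jump operator. -/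

section JumpError

variable {n : Type*} [Fintype n] [DecidableEq n]

/-- Entrywise (Schur) multiplication as a ring homomorphism into the superoperators. -/
noncomputable def schurMul : (n → n → ℂ) →+* (Matrix n n ℂ →L[ℂ] Matrix n n ℂ) where
  toFun g := LinearMap.toContinuousLinearMap
    { toFun := fun X => Matrix.of fun i j => g i j * X i j
      map_add' := fun X Y => by ext i j; simp [mul_add]
      map_smul' := fun c X => by ext i j; simp [mul_left_comm] }
  map_one' := by ext X i j; simp
  map_mul' g h := by ext X i j; simp [mul_assoc]
  map_zero' := by ext X i j; simp
  map_add' g h := by ext X i j; simp [add_mul]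

omit [DecidableEq n] in
lemma schurMul_apply (g : n → n → ℂ) (X : Matrix n n ℂ) :
    schurMul g X = Matrix.of fun i j => g i j * X i j := rfl

omit [DecidableEq n] in
lemma schurMul_smul (c : ℂ) (g : n → n → ℂ) : schurMul (c • g) = c • schurMul g := by
  ext X i j
  simp [schurMul_apply, mul_assoc]

omit [DecidableEq n] in
lemma continuous_schurMul : Continuous (schurMul (n := n)) :=
  LinearMap.continuous_of_finiteDimensional
    ({ toFun := schurMul, map_add' := map_add _, map_smul' := schurMul_smul } :
      (n → n → ℂ) →ₗ[ℂ] (Matrix n n ℂ →L[ℂ] Matrix n n ℂ))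

/-- `schurMul` is a continuous ring homomorphism from functions under pointwise product, so it
commutes with the exponential. -/
lemma exp_schurMul (g : n → n → ℂ) :
    NormedSpace.exp (schurMul g) = schurMul fun i j => Complex.exp (g i j) := by
  have h := ringHom_map_exp (𝔸 := Matrix n n ℂ →L[ℂ] Matrix n n ℂ) (schurMul (n := n)) continuous_schurMul g
  rw [← h]
  congr 1
  ext i j
  rw [Pi.coe_exp, Pi.coe_exp, Complex.exp_eq_exp_ℂ]

variable {H : Matrix n n ℂ} (hH : H.IsHermitian)

/-- Multiplication by the eigenvalue differences is the commutator with diag(E). This makes the jump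
bound independent of the dimension. -/
lemma norm_schurMul_bohr_le :
    ‖schurMul fun i j => ((hH.eigenvalues i - hH.eigenvalues j : ℝ) : ℂ)‖ ≤ 2 * ‖H‖ := by
  refine ContinuousLinearMap.opNorm_le_bound _ (by positivity) fun X => ?_
  set Λ : Matrix n n ℂ := Matrix.diagonal fun i => (hH.eigenvalues i : ℂ) with hΛ
  have hn : ‖Λ‖ = ‖H‖ := by rw [← norm_ofEigenbasis hH, ofEigenbasis_diagonal]
  have e : schurMul (fun i j => ((hH.eigenvalues i - hH.eigenvalues j : ℝ) : ℂ)) X =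
      Λ * X - X * Λ := by
    ext i j
    rw [schurMul_apply, hΛ, Matrix.sub_apply, Matrix.diagonal_mul, Matrix.mul_diagonal,
      Matrix.of_apply]
    push_cast
    ring
  rw [e]
  have h1 := norm_sub_le (Λ * X) (X * Λ)
  have h2 := norm_mul_le Λ X
  have h3 := norm_mul_le X Λ
  rw [hn] at h2 h3
  linarith

include hH in
-- The error is f̂(ω) times exp(2xS − S²) − 1 − 2xS applied to `A` in the eigenbasis, with x = βω/2
-- and S entrywise multiplication by βν/2.
lemma norm_jump_sub_truncatedJump_le_exp {β : ℝ} (hβ : 0 < β) (A : Matrix n n ℂ) (ω : ℝ) :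
    ‖jump H A β ω - truncatedJump H A β ω‖ ≤ filterHat β ω *
      (1.88 * (β * ‖H‖) ^ 2 * Real.exp ((β * ω / 2) ^ 2 / 2 + 5 * (β * ‖H‖) ^ 2)) * ‖A‖ := by
  set A' := (ofEigenbasis hH).symm A with hA'
  have hnA : ‖A'‖ = ‖A‖ := norm_ofEigenbasis_symm hH A
  set ν : n → n → ℂ := fun i j => ((hH.eigenvalues i - hH.eigenvalues j : ℝ) : ℂ) with hν
  set x := β * ω / 2 with hx
  set S := schurMul ((β / 2 : ℂ) • ν) with hS
  have hSn : ‖S‖ ≤ β * ‖H‖ := by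
    have h1 := norm_schurMul_bohr_le hH
    have h2 : ‖(β / 2 : ℂ)‖ = β / 2 := by
      rw [norm_div, Complex.norm_real, Real.norm_of_nonneg hβ.le]; simp
    rw [hS, schurMul_smul, norm_smul, h2]
    calc β / 2 * ‖schurMul ν‖ ≤ β / 2 * (2 * ‖H‖) := by gcongr
      _ = β * ‖H‖ := by ring
  have hf : 0 ≤ filterHat β ω := mul_nonneg (filterAmp_nonneg hβ) (Real.exp_nonneg _)
  have hY : (2 * x : ℂ) • S - S ^ 2 =
      schurMul ((2 * x : ℂ) • ((β / 2 : ℂ) • ν) - ((β / 2 : ℂ) • ν) ^ 2) := by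
    rw [map_sub, schurMul_smul, map_pow]
  have e : jump H A β ω - truncatedJump H A β ω = ofEigenbasis hH ((filterHat β ω : ℂ) •
      ((NormedSpace.exp ((2 * x : ℂ) • S - S ^ 2) - 1 - (2 * x : ℂ) • S) A')) := by
    rw [jump_eq hH hβ, truncatedJump_eq hH hβ, ← map_sub, hY, exp_schurMul, hS, ← schurMul_smul,
      ← hA']
    congr 1
    ext i j
    simp only [_root_.sub_apply, Matrix.sub_apply, schurMul_apply, Matrix.of_apply,
      Matrix.smul_apply, _root_.one_apply_eq_self, Pi.smul_apply, Pi.sub_apply, Pi.pow_apply,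
      smul_eq_mul]
    have h1 : (filterHat β (ω - (hH.eigenvalues i - hH.eigenvalues j)) : ℂ) =
        (filterHat β ω : ℂ) *
          Complex.exp (2 * x * (β / 2 * ν i j) - (β / 2 * ν i j) ^ 2) := by
      have h2 : (2 * x * (β / 2 * ν i j) - (β / 2 * ν i j) ^ 2 : ℂ) =
          ((2 * x * (β / 2 * (hH.eigenvalues i - hH.eigenvalues j)) -
            (β / 2 * (hH.eigenvalues i - hH.eigenvalues j)) ^ 2 : ℝ) : ℂ) := by
        rw [hν]; push_cast; ring
      rw [h2, ← Complex.ofReal_exp, ← Complex.ofReal_mul, filterHat, filterHat, mul_assoc,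
        ← Real.exp_add]
      congr 3
      rw [hx]
      ring
    rw [h1]
    simp only [hν, hx]
    push_cast
    ring
  rw [e, norm_ofEigenbasis, norm_smul, Complex.norm_real, Real.norm_of_nonneg hf, mul_assoc]
  gcongr
  refine (ContinuousLinearMap.le_opNorm _ _).trans ?_
  rw [hnA]
  gcongr
  exact norm_exp_hermite_remainder_le hSn x

lemma deltaEven_eq (H A : Matrix n n ℂ) {β : ℝ} (hβ : 0 < β) :
    deltaEven H A β = (2 : ℝ) ^ (1 / 4 : ℝ) * √β * (β * ‖H‖) ^ 2 * ‖A‖ *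
      Real.exp (5 * (β * ‖H‖) ^ 2) := by
  have hpi := Real.pi_pos
  have h1 : (2 * β ^ 2 / Real.pi) ^ (1 / 4 : ℝ) * Real.pi ^ (1 / 4 : ℝ) =
      (2 : ℝ) ^ (1 / 4 : ℝ) * √β := by
    rw [← Real.mul_rpow (by positivity) hpi.le, div_mul_cancel₀ _ hpi.ne',
      Real.mul_rpow (by norm_num) (by positivity), ← Real.rpow_natCast, ← Real.rpow_mul hβ.le,
      Real.sqrt_eq_rpow]
    norm_num
  rw [deltaEven, h1, mul_assoc _ (Real.exp _), ← Real.exp_add]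
  congr 2
  ring

lemma deltaEven_nonneg (H A : Matrix n n ℂ) {β : ℝ} (hβ : 0 < β) : 0 ≤ deltaEven H A β := by
  rw [deltaEven_eq H A hβ]; positivity

lemma deltaOdd_nonneg (H A : Matrix n n ℂ) {β : ℝ} (hβ : 0 < β) : 0 ≤ deltaOdd H A β := by
  have : 0 ≤ Real.exp (4 * β ^ 2 * ‖H‖ ^ 2) - 1 :=
    sub_nonneg.2 (Real.one_le_exp (by positivity))
  have hpi := Real.pi_pos
  unfold deltaOdd
  positivity

include hH in
/-- The truncation error of a jump operator in the spectral norm. -/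
theorem norm_jump_sub_truncatedJump_le {β : ℝ} (hβ : 0 < β) (A : Matrix n n ℂ) (ω : ℝ) :
    ‖jump H A β ω - truncatedJump H A β ω‖ ≤ delta H A β ω := by
  have hpi := Real.pi_gt_d2
  refine (norm_jump_sub_truncatedJump_le_exp hH hβ A ω).trans ?_
  -- The odd part enters only through its sign; the even part carries the whole estimate.
  have ho : 0 ≤ deltaOdd H A β * |ω| * Real.exp (-(β ^ 2 * ω ^ 2) / 4) := by
    have := deltaOdd_nonneg H A hβ
    positivity
  -- This is 1.88⁴ ≤ 4π: numerically 12.492 against 12.56 from π > 3.14.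
  have hc : 1.88 / (2 * Real.pi) ^ (1 / 4 : ℝ) ≤ (2 : ℝ) ^ (1 / 4 : ℝ) := by
    rw [div_le_iff₀ (by positivity), ← Real.mul_rpow (by norm_num) (by positivity)]
    calc (1.88 : ℝ) = (1.88 ^ 4) ^ (1 / 4 : ℝ) := by
          rw [← Real.rpow_natCast, ← Real.rpow_mul (by norm_num)]; norm_num
      _ ≤ (2 * (2 * Real.pi)) ^ (1 / 4 : ℝ) := by
          refine Real.rpow_le_rpow (by norm_num) ?_ (by norm_num)
          norm_num
          linarith
  have e : filterHat β ω *
      (1.88 * (β * ‖H‖) ^ 2 * Real.exp ((β * ω / 2) ^ 2 / 2 + 5 * (β * ‖H‖) ^ 2)) * ‖A‖ =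
      1.88 / (2 * Real.pi) ^ (1 / 4 : ℝ) * (√β * (β * ‖H‖) ^ 2 * ‖A‖ *
        Real.exp (5 * (β * ‖H‖) ^ 2) * Real.exp (-(β ^ 2 * ω ^ 2) / 8)) := by
    have h1 : Real.exp (-(β ^ 2 * ω ^ 2) / 4) *
        Real.exp ((β * ω / 2) ^ 2 / 2 + 5 * (β * ‖H‖) ^ 2) =
        Real.exp (5 * (β * ‖H‖) ^ 2) * Real.exp (-(β ^ 2 * ω ^ 2) / 8) := by
      rw [← Real.exp_add, ← Real.exp_add]
      congr 1
      ring
    rw [filterHat, filterAmp_eq hβ]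
    linear_combination (√β / (2 * Real.pi) ^ (1 / 4 : ℝ) * 1.88 * (β * ‖H‖) ^ 2 * ‖A‖) * h1
  rw [e, delta, deltaEven_eq H A hβ]
  have h2 := mul_le_mul_of_nonneg_right hc (by positivity : 0 ≤ √β * (β * ‖H‖) ^ 2 * ‖A‖ *
        Real.exp (5 * (β * ‖H‖) ^ 2) * Real.exp (-(β ^ 2 * ω ^ 2) / 8))
  linarith

end JumpError

/-! ### The transition weight and integrability against it. -/

section Weight

lemma transitionWeight_nonneg (β ω : ℝ) : 0 ≤ transitionWeight β ω := Real.exp_nonneg _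

lemma continuous_transitionWeight (β : ℝ) : Continuous (transitionWeight β) := by
  unfold transitionWeight; fun_prop

lemma integrable_transitionWeight {β : ℝ} (hβ : 0 < β) : Integrable (transitionWeight β) := by
  have h := ((integrable_exp_neg_mul_sq (b := 1 / 2) (by norm_num)).comp_add_right 1).comp_mul_left'
    hβ.ne'
  refine h.congr (Eventually.of_forall fun ω => ?_)
  simp only [transitionWeight]
  congr 1
  ring

/-- Bounded jumps stay in a compact ball of the proper space E, so the continuous G is bounded along
them and the Gaussian weight dominates. -/
lemma integrable_transitionWeight_smul {𝕜 E F : Type*} [RCLike 𝕜] [NormedAddCommGroup E]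
    [ProperSpace E] [NormedAddCommGroup F] [NormedSpace 𝕜 F] {β : ℝ} (hβ : 0 < β)
    {J : ℝ → E} (hJ : Continuous J) {C : ℝ} (hC : ∀ ω, ‖J ω‖ ≤ C) {G : E → F}
    (hG : Continuous G) : Integrable fun ω : ℝ => (transitionWeight β ω : 𝕜) • G (J ω) := by
  obtain ⟨K, hK⟩ := (isCompact_closedBall (0 : E) C).exists_bound_of_continuousOn hG.continuousOn
  refine ((integrable_transitionWeight hβ).mul_const K).mono' ?_ (Eventually.of_forall fun ω => ?_)
  · exact ((RCLike.continuous_ofReal.comp (continuous_transitionWeight β)).smul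
      (hG.comp hJ)).aestronglyMeasurable
  · rw [norm_smul, RCLike.norm_ofReal, abs_of_nonneg (transitionWeight_nonneg β ω)]
    exact mul_le_mul_of_nonneg_left (hK _ (by simpa using hC ω)) (transitionWeight_nonneg β ω)

lemma abs_mul_exp_neg_sq_le_one (y : ℝ) : |y| * Real.exp (-y ^ 2) ≤ 1 := by
  rw [Real.exp_neg, ← div_eq_mul_inv, div_le_one (Real.exp_pos _)]
  have h1 := Real.add_one_le_exp (y ^ 2)
  have h2 := sq_nonneg (|y| - 1)
  have h3 := sq_abs y
  nlinarith [abs_nonneg y]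

lemma mul_abs_mul_exp_le {β : ℝ} (hβ : 0 < β) (ω : ℝ) :
    β * |ω| * Real.exp (-(β ^ 2 * ω ^ 2) / 4) ≤ 2 := by
  have h := abs_mul_exp_neg_sq_le_one (β * ω / 2)
  have e : -(β * ω / 2) ^ 2 = -(β ^ 2 * ω ^ 2) / 4 := by ring
  rw [e, abs_div, abs_mul, abs_of_pos hβ, abs_two] at h
  linarith

end Weight

/-! ### From jump errors to Lindbladian errors. -/

section Bounds

variable {n : Type*} [Fintype n] [DecidableEq n] {H : Matrix n n ℂ} (hH : H.IsHermitian)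

lemma continuous_filterHat (β : ℝ) : Continuous (filterHat β) := by
  unfold filterHat; fun_prop

lemma filterHat_nonneg {β : ℝ} (hβ : 0 < β) (ω : ℝ) : 0 ≤ filterHat β ω :=
  mul_nonneg (filterAmp_nonneg hβ) (Real.exp_nonneg _)

lemma filterHat_le {β : ℝ} (hβ : 0 < β) (ω : ℝ) : filterHat β ω ≤ filterAmp β :=
  mul_le_of_le_one_right (filterAmp_nonneg hβ) (Real.exp_le_one_iff.2 (by
    have : 0 ≤ β ^ 2 * ω ^ 2 := by positivity
    linarith))

include hH in
lemma continuous_jump {β : ℝ} (hβ : 0 < β) (A : Matrix n n ℂ) : Continuous (jump H A β) := by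
  have : jump H A β = fun ω => ofEigenbasisCLM hH (Matrix.of fun i j =>
      (filterHat β (ω - (hH.eigenvalues i - hH.eigenvalues j)) : ℂ) *
        (ofEigenbasis hH).symm A i j) := funext (jump_eq hH hβ A)
  rw [this]
  refine (ofEigenbasisCLM hH).continuous.comp (continuous_matrix fun i j => ?_)
  exact (Complex.continuous_ofReal.comp
    ((continuous_filterHat β).comp (continuous_id.sub continuous_const))).mul continuous_const

include hH in
lemma continuous_truncatedJump {β : ℝ} (hβ : 0 < β) (A : Matrix n n ℂ) :
    Continuous (truncatedJump H A β) := by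
  have : truncatedJump H A β = fun ω => ofEigenbasisCLM hH (Matrix.of fun i j =>
      ((filterHat β ω * (1 + β ^ 2 * ω / 2 * (hH.eigenvalues i - hH.eigenvalues j)) : ℝ) : ℂ) *
        (ofEigenbasis hH).symm A i j) := funext (truncatedJump_eq hH hβ A)
  rw [this]
  refine (ofEigenbasisCLM hH).continuous.comp (continuous_matrix fun i j => ?_)
  refine (Complex.continuous_ofReal.comp ((continuous_filterHat β).mul ?_)).mul continuous_const
  fun_prop

include hH in
lemma exists_norm_jump_le {β : ℝ} (hβ : 0 < β) (A : Matrix n n ℂ) :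
    ∃ C, ∀ ω, ‖jump H A β ω‖ ≤ C := by
  refine ⟨∑ i, ∑ j, filterAmp β * ‖(ofEigenbasis hH).symm A i j‖, fun ω => ?_⟩
  rw [jump_eq hH hβ, norm_ofEigenbasis]
  refine (norm_le_sum_norm_apply _).trans
    (Finset.sum_le_sum fun i _ => Finset.sum_le_sum fun j _ => ?_)
  rw [Matrix.of_apply, norm_mul, Complex.norm_real, Real.norm_of_nonneg (filterHat_nonneg hβ _)]
  gcongr
  exact filterHat_le hβ _

/-- The factor linear in ω is tamed by β|ω|exp(−β²ω²/4) ≤ 2. The bound is uniform in ω and of order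
√β, hence eventually below 1. -/
lemma norm_truncatedJump_le {β : ℝ} (hβ : 0 < β) (A : Matrix n n ℂ) (ω : ℝ) :
    ‖truncatedJump H A β ω‖ ≤ filterAmp β * ∑ i, ∑ j,
      (1 + β * |hH.eigenvalues i - hH.eigenvalues j|) * ‖(ofEigenbasis hH).symm A i j‖ := by
  rw [truncatedJump_eq hH hβ, norm_ofEigenbasis, Finset.mul_sum]
  refine (norm_le_sum_norm_apply _).trans (Finset.sum_le_sum fun i _ => ?_)
  rw [Finset.mul_sum]
  refine Finset.sum_le_sum fun j _ => ?_
  rw [Matrix.of_apply, norm_mul, Complex.norm_real, ← mul_assoc]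
  gcongr
  rw [norm_mul, Real.norm_of_nonneg (filterHat_nonneg hβ _)]
  set ν := hH.eigenvalues i - hH.eigenvalues j
  have h1 : ‖1 + β ^ 2 * ω / 2 * ν‖ ≤ 1 + β ^ 2 * |ω| / 2 * |ν| := by
    refine (norm_add_le _ _).trans (le_of_eq ?_)
    rw [norm_one, Real.norm_eq_abs, abs_mul, abs_div, abs_mul, abs_two, abs_of_nonneg (sq_nonneg β)]
  have h2 := mul_abs_mul_exp_le hβ ω
  have h3 := filterAmp_nonneg hβ
  calc filterHat β ω * ‖1 + β ^ 2 * ω / 2 * ν‖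
      ≤ filterHat β ω * (1 + β ^ 2 * |ω| / 2 * |ν|) := by
        have := filterHat_nonneg hβ ω
        gcongr
    _ = filterHat β ω + filterAmp β * (β / 2 * |ν|) *
          (β * |ω| * Real.exp (-(β ^ 2 * ω ^ 2) / 4)) := by
        rw [filterHat]; ring
    _ ≤ filterAmp β + filterAmp β * (β / 2 * |ν|) * 2 := by
        gcongr
        exact filterHat_le hβ ω
    _ = filterAmp β * (1 + β * |ν|) := by ring

include hH in
lemma eventually_norm_truncatedJump_le_one (A : Matrix n n ℂ) :
    ∀ᶠ β in 𝓝[>] (0 : ℝ), ∀ ω : ℝ, ‖truncatedJump H A β ω‖ ≤ 1 := by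
  have hc : Continuous fun β : ℝ => √β / (2 * Real.pi) ^ (1 / 4 : ℝ) * ∑ i, ∑ j,
      (1 + β * |hH.eigenvalues i - hH.eigenvalues j|) * ‖(ofEigenbasis hH).symm A i j‖ := by
    fun_prop
  have ht := (hc.tendsto 0).mono_left (nhdsWithin_le_nhds (s := Set.Ioi 0))
  rw [Real.sqrt_zero, zero_div, zero_mul] at ht
  filter_upwards [ht.eventually_le_const zero_lt_one, self_mem_nhdsWithin] with β h1 hβ ω
  refine (norm_truncatedJump_le hH hβ A ω).trans ?_
  rwa [filterAmp_eq hβ]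

lemma continuous_delta (H A : Matrix n n ℂ) (β : ℝ) : Continuous (delta H A β) := by
  unfold delta; fun_prop

lemma norm_delta_le (H A : Matrix n n ℂ) {β : ℝ} (hβ : 0 < β) (ω : ℝ) :
    ‖delta H A β ω‖ ≤ deltaEven H A β + deltaOdd H A β * (2 / β) := by
  have h1 := deltaEven_nonneg H A hβ
  have h2 := deltaOdd_nonneg H A hβ
  have h3 : |ω| * Real.exp (-(β ^ 2 * ω ^ 2) / 4) ≤ 2 / β := by
    rw [le_div_iff₀ hβ]
    linarith [mul_abs_mul_exp_le hβ ω]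
  have h4 : Real.exp (-(β ^ 2 * ω ^ 2) / 8) ≤ 1 := Real.exp_le_one_iff.2 (by
    have : 0 ≤ β ^ 2 * ω ^ 2 := by positivity
    linarith)
  rw [Real.norm_of_nonneg (by unfold delta; positivity), delta, mul_assoc (deltaOdd H A β)]
  exact add_le_add (mul_le_of_le_one_right h1 h4) (mul_le_mul_of_nonneg_left h3 h2)

lemma integrable_transitionWeight_mul_delta (H A : Matrix n n ℂ) {β : ℝ} (hβ : 0 < β) :
    Integrable fun ω => transitionWeight β ω * (4 * delta H A β ω + 2 * delta H A β ω ^ 2) :=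
  integrable_transitionWeight_smul (𝕜 := ℝ) hβ (continuous_delta H A β) (norm_delta_le H A hβ)
    (G := fun d : ℝ => 4 * d + 2 * d ^ 2) (by fun_prop)

lemma continuous_dissipator :
    Continuous (dissipator : Matrix n n ℂ → (Matrix n n ℂ →L[ℂ] Matrix n n ℂ)) := by
  refine (continuous_clm_apply (𝕜 := ℂ) (E := Matrix n n ℂ) (F := Matrix n n ℂ)).2 fun X => ?_
  have h1 : Continuous fun L : Matrix n n ℂ => L := continuous_id
  have h2 : Continuous fun L : Matrix n n ℂ => Lᴴ := h1.matrix_conjTranspose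
  have h3 : Continuous fun _ : Matrix n n ℂ => X := continuous_const
  have h4 : Continuous fun L : Matrix n n ℂ => Lᴴ * L * X + X * (Lᴴ * L) :=
    ((h2.matrix_mul h1).matrix_mul h3).add (h3.matrix_mul (h2.matrix_mul h1))
  exact ((h1.matrix_mul h3).matrix_mul h2).sub (h4.const_smul (1 / 2 : ℂ))

lemma integrable_dissipator {β : ℝ} (hβ : 0 < β) {J : ℝ → Matrix n n ℂ} (hJ : Continuous J)
    {C : ℝ} (hC : ∀ ω, ‖J ω‖ ≤ C) :
    Integrable fun ω : ℝ => (transitionWeight β ω : ℂ) • dissipator (J ω) := by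
  have := FiniteDimensional.proper ℂ (Matrix n n ℂ)
  exact integrable_transitionWeight_smul (𝕜 := ℂ) (E := Matrix n n ℂ)
    (F := Matrix n n ℂ →L[ℂ] Matrix n n ℂ) hβ hJ hC continuous_dissipator

variable {ι : Type*} [Fintype ι]

lemma idealLindbladian_sub_approxLindbladian (A : ι → Matrix n n ℂ) {β : ℝ} (hβ : 0 < β) :
    (∀ a, Integrable fun ω : ℝ => (transitionWeight β ω : ℂ) •
      (dissipator (jump H (A a) β ω) - dissipator (truncatedJump H (A a) β ω))) ∧
    idealLindbladian H hH A β - approxLindbladian H hH A β =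
      ∑ a, ∫ ω : ℝ, (transitionWeight β ω : ℂ) •
        (dissipator (jump H (A a) β ω) - dissipator (truncatedJump H (A a) β ω)) := by
  have i1 : ∀ a, Integrable fun ω : ℝ =>
      (transitionWeight β ω : ℂ) • dissipator (jump H (A a) β ω) := fun a => by
    obtain ⟨C, hC⟩ := exists_norm_jump_le hH hβ (A a)
    exact integrable_dissipator hβ (continuous_jump hH hβ _) hC
  have i2 : ∀ a, Integrable fun ω : ℝ =>
      (transitionWeight β ω : ℂ) • dissipator (truncatedJump H (A a) β ω) := fun a =>
    integrable_dissipator hβ (continuous_truncatedJump hH hβ _) (norm_truncatedJump_le hH hβ _)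
  simp only [smul_sub]
  have i3 := fun a => Integrable.sub (β := Matrix n n ℂ →L[ℂ] Matrix n n ℂ) (i1 a) (i2 a)
  refine ⟨i3, ?_⟩
  rw [idealLindbladian, approxLindbladian, lindbladian, lindbladian, add_sub_add_left_eq_sub,
    ← Finset.sum_sub_distrib]
  exact Finset.sum_congr rfl fun a _ => (integral_sub (i1 a) (i2 a)).symm

/-- Stated for a general linear Θ and contraction π so that one proof serves twice: with Θ the
ancilla extension and π the amplification, and with Θ evaluation at X and π the identity. -/
lemma traceNorm_map_lindbladian_sub_le {m : Type*} [Fintype m] [DecidableEq m]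
    (A : ι → Matrix n n ℂ) {β : ℝ} (hβ : 0 < β)
    (hA : ∀ (a : ι) (ω : ℝ), ‖truncatedJump H (A a) β ω‖ ≤ 1)
    (Θ : (Matrix n n ℂ →L[ℂ] Matrix n n ℂ) →L[ℂ] Matrix m m ℂ) (π : Matrix n n ℂ → Matrix m m ℂ)
    (hπ : ∀ L, ‖π L‖ ≤ ‖L‖) (hsub : ∀ L M, π (L - M) = π L - π M) (X : Matrix m m ℂ)
    (hΘ : ∀ L, Θ (dissipator L) = dissipator (π L) X) :
    traceNorm (Θ (idealLindbladian H hH A β - approxLindbladian H hH A β)) ≤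
      errorBound H A β * traceNorm X := by
  obtain ⟨hi, he⟩ := idealLindbladian_sub_approxLindbladian hH A hβ
  have hc := fun a => ContinuousLinearMap.integral_comp_comm
    (E := Matrix n n ℂ →L[ℂ] Matrix n n ℂ) Θ (hi a)
  rw [he, map_sum]
  simp_rw [← hc]
  rw [errorBound, Finset.sum_mul]
  simp_rw [← integral_mul_const]
  refine traceNorm_sum_integral_le (fun a => ?_)
    (fun a => (integrable_transitionWeight_mul_delta H (A a) hβ).mul_const _) fun a ω => ?_
  · exact ContinuousLinearMap.integrable_comp (H := Matrix n n ℂ →L[ℂ] Matrix n n ℂ) Θ (hi a)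
  rw [map_smul, map_sub, hΘ, hΘ]
  refine (traceNorm_smul_le _ _).trans ?_
  rw [Complex.norm_real, Real.norm_of_nonneg (transitionWeight_nonneg β ω), mul_assoc]
  refine mul_le_mul_of_nonneg_left ?_ (transitionWeight_nonneg β ω)
  refine traceNorm_dissipator_sub_le ((hπ _).trans (hA a ω)) ?_ X
  rw [← hsub]
  exact (hπ _).trans (norm_jump_sub_truncatedJump_le hH hβ (A a) ω)

/-- The diamond-norm bound on the difference of the ideal and the approximate Lindbladian. -/
theorem diamondNorm_lindbladian_sub_le (A : ι → Matrix n n ℂ) {β : ℝ} (hβ : 0 < β)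
    (hA : ∀ (a : ι) (ω : ℝ), ‖truncatedJump H (A a) β ω‖ ≤ 1) :
    diamondNorm (idealLindbladian H hH A β - approxLindbladian H hH A β) ≤
      ENNReal.ofReal (errorBound H A β) := by
  have hE : 0 ≤ errorBound H A β := Finset.sum_nonneg fun a _ => integral_nonneg fun ω => by
    have h1 := transitionWeight_nonneg β ω
    have h2 := (norm_nonneg _).trans (norm_jump_sub_truncatedJump_le hH hβ (A a) ω)
    simp only [Pi.zero_apply]
    positivity
  refine iSup_le fun k => iSup_le fun X => iSup_le fun _ => ENNReal.ofReal_le_ofReal ?_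
  refine div_le_of_le_mul₀ (traceNorm_nonneg X) hE ?_
  exact traceNorm_map_lindbladian_sub_le hH A hβ hA (extendApply X) (amplify k)
    (norm_amplify_le k) (amplify_sub k) X fun L => extend_dissipator L X

lemma traceNorm_lindbladian_sub_apply_le (A : ι → Matrix n n ℂ) {β : ℝ} (hβ : 0 < β)
    (hA : ∀ (a : ι) (ω : ℝ), ‖truncatedJump H (A a) β ω‖ ≤ 1) (X : Matrix n n ℂ) :
    traceNorm (idealLindbladian H hH A β X - approxLindbladian H hH A β X) ≤
      errorBound H A β * traceNorm X :=
  traceNorm_map_lindbladian_sub_le hH A hβ hA (ContinuousLinearMap.apply ℂ (Matrix n n ℂ) X) id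
    (fun _ => le_rfl) (fun _ _ => rfl) X fun _ => rfl

end Bounds

/-! ### High-temperature expansion of the error bound. -/

section Expansion

lemma rpow_three_halves {β : ℝ} (hβ : 0 < β) : β ^ (3 / 2 : ℝ) = β * √β := by
  rw [Real.sqrt_eq_rpow, ← Real.rpow_one_add' hβ.le (by norm_num)]
  norm_num

lemma rpow_five_halves {β : ℝ} (hβ : 0 < β) : β ^ (5 / 2 : ℝ) = β ^ 2 * √β := by
  rw [Real.sqrt_eq_rpow, ← Real.rpow_natCast, ← Real.rpow_add hβ]
  norm_num

lemma exp_sub_one_le_mul_exp (x : ℝ) : Real.exp x - 1 ≤ x * Real.exp x := by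
  have h1 := Real.add_one_le_exp (-x)
  have h2 : Real.exp (-x) * Real.exp x = 1 := by rw [← Real.exp_add]; simp
  nlinarith [Real.exp_pos x]

/-- Complete the square: (u+1)²/2 + u²/8 = (5/8)(u + 4/5)² + 1/10. -/
lemma integral_transitionWeight_one_mul_exp :
    ∫ u : ℝ, transitionWeight 1 u * Real.exp (-u ^ 2 / 8) =
      √(8 * Real.pi / 5) * Real.exp (-(1 / 10)) := by
  have e : ∀ u : ℝ, transitionWeight 1 u * Real.exp (-u ^ 2 / 8) =
      (fun v : ℝ => Real.exp (-(5 / 8) * v ^ 2) * Real.exp (-(1 / 10))) (u + 4 / 5) := fun u => by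
    simp only [transitionWeight]
    rw [← Real.exp_add, ← Real.exp_add]
    congr 1
    ring
  rw [integral_congr_ae (Eventually.of_forall e), integral_add_right_eq_self (μ := volume)
    (fun v : ℝ => Real.exp (-(5 / 8) * v ^ 2) * Real.exp (-(1 / 10))) (4 / 5), integral_mul_const, integral_gaussian]
  congr 2
  field_simp

variable {n : Type*} [Fintype n] [DecidableEq n]

/-- The substitution u = βω moves all β-dependence into the prefactor and the two coefficients. -/
lemma integral_weighted_delta_eq (H A : Matrix n n ℂ) {β : ℝ} (hβ : 0 < β) :
    ∫ ω : ℝ, transitionWeight β ω * (4 * delta H A β ω + 2 * delta H A β ω ^ 2) =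
      β⁻¹ * ∫ u : ℝ, transitionWeight 1 u *
        (4 * (deltaEven H A β * Real.exp (-u ^ 2 / 8) +
          deltaOdd H A β / β * (|u| * Real.exp (-u ^ 2 / 4))) +
        2 * (deltaEven H A β * Real.exp (-u ^ 2 / 8) +
          deltaOdd H A β / β * (|u| * Real.exp (-u ^ 2 / 4))) ^ 2) := by
  have h := Measure.integral_comp_mul_left (fun u : ℝ => transitionWeight 1 u *
        (4 * (deltaEven H A β * Real.exp (-u ^ 2 / 8) +
          deltaOdd H A β / β * (|u| * Real.exp (-u ^ 2 / 4))) +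
        2 * (deltaEven H A β * Real.exp (-u ^ 2 / 8) +
          deltaOdd H A β / β * (|u| * Real.exp (-u ^ 2 / 4))) ^ 2)) β
  rw [abs_of_pos (inv_pos.2 hβ), smul_eq_mul] at h
  rw [← h]
  congr 1
  ext ω
  have e1 : delta H A β ω = deltaEven H A β * Real.exp (-(β * ω) ^ 2 / 8) +
      deltaOdd H A β / β * (|β * ω| * Real.exp (-(β * ω) ^ 2 / 4)) := by
    rw [delta, abs_mul, abs_of_pos hβ, mul_pow]
    field_simp
  have e2 : transitionWeight β ω = transitionWeight 1 (β * ω) := by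
    rw [transitionWeight, transitionWeight, one_mul]
  rw [e1, e2]

/-- Isolates the term linear in the even coefficient p. In the application p = O(β^{5/2}) and q =
O(β^{7/2}), so the right-hand side is O(β^{7/2}), one power of β smaller than p. -/
lemma abs_integral_weighted_sub_le {p q : ℝ} (hp : 0 ≤ p) (hq : 0 ≤ q) :
    |(∫ u : ℝ, transitionWeight 1 u *
        (4 * (p * Real.exp (-u ^ 2 / 8) + q * (|u| * Real.exp (-u ^ 2 / 4))) +
        2 * (p * Real.exp (-u ^ 2 / 8) + q * (|u| * Real.exp (-u ^ 2 / 4))) ^ 2)) -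
      4 * p * (√(8 * Real.pi / 5) * Real.exp (-(1 / 10)))| ≤
      (8 * q + 2 * (p + 2 * q) ^ 2) * ∫ u : ℝ, transitionWeight 1 u := by
  have hg := integrable_transitionWeight one_pos
  have hgc := continuous_transitionWeight 1
  have b1 : ∀ u : ℝ, Real.exp (-u ^ 2 / 8) ≤ 1 := fun u =>
    Real.exp_le_one_iff.2 (by nlinarith [sq_nonneg u])
  have b2 : ∀ u : ℝ, |u| * Real.exp (-u ^ 2 / 4) ≤ 2 := fun u => by
    simpa using mul_abs_mul_exp_le one_pos u
  have i1 : Integrable fun u : ℝ => transitionWeight 1 u * Real.exp (-u ^ 2 / 8) := by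
    refine hg.mono' (by fun_prop) (Eventually.of_forall fun u => ?_)
    rw [Real.norm_of_nonneg (mul_nonneg (transitionWeight_nonneg 1 u) (Real.exp_nonneg _))]
    exact mul_le_of_le_one_right (transitionWeight_nonneg 1 u) (b1 u)
  have key : ∀ u : ℝ, ‖transitionWeight 1 u *
      (4 * (q * (|u| * Real.exp (-u ^ 2 / 4))) +
        2 * (p * Real.exp (-u ^ 2 / 8) + q * (|u| * Real.exp (-u ^ 2 / 4))) ^ 2)‖ ≤
      (8 * q + 2 * (p + 2 * q) ^ 2) * transitionWeight 1 u := fun u => by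
    have h0 := transitionWeight_nonneg 1 u
    have h1 : p * Real.exp (-u ^ 2 / 8) ≤ p := mul_le_of_le_one_right hp (b1 u)
    have h2 : q * (|u| * Real.exp (-u ^ 2 / 4)) ≤ q * 2 := mul_le_mul_of_nonneg_left (b2 u) hq
    rw [Real.norm_of_nonneg (by positivity), mul_comm]
    refine mul_le_mul_of_nonneg_right (add_le_add (by linarith) ?_) h0
    have h3 : 0 ≤ p * Real.exp (-u ^ 2 / 8) + q * (|u| * Real.exp (-u ^ 2 / 4)) := by positivity
    exact mul_le_mul_of_nonneg_left (pow_le_pow_left₀ h3 (by linarith) 2) (by norm_num)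
  have i2 : Integrable fun u : ℝ => transitionWeight 1 u *
      (4 * (q * (|u| * Real.exp (-u ^ 2 / 4))) +
        2 * (p * Real.exp (-u ^ 2 / 8) + q * (|u| * Real.exp (-u ^ 2 / 4))) ^ 2) :=
    (hg.const_mul _).mono' (by fun_prop) (Eventually.of_forall key)
  have e : ∀ u : ℝ, transitionWeight 1 u *
        (4 * (p * Real.exp (-u ^ 2 / 8) + q * (|u| * Real.exp (-u ^ 2 / 4))) +
        2 * (p * Real.exp (-u ^ 2 / 8) + q * (|u| * Real.exp (-u ^ 2 / 4))) ^ 2) =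
      4 * p * (transitionWeight 1 u * Real.exp (-u ^ 2 / 8)) + transitionWeight 1 u *
      (4 * (q * (|u| * Real.exp (-u ^ 2 / 4))) +
        2 * (p * Real.exp (-u ^ 2 / 8) + q * (|u| * Real.exp (-u ^ 2 / 4))) ^ 2) :=
    fun u => by ring
  simp_rw [e]
  rw [integral_add (i1.const_mul _) i2, integral_const_mul, integral_transitionWeight_one_mul_exp,
    add_sub_cancel_left, ← integral_const_mul, ← Real.norm_eq_abs]
  exact norm_integral_le_of_norm_le (hg.const_mul _) (Eventually.of_forall key)

lemma leading_coefficient_eq (a h : ℝ) :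
    8 * (2 : ℝ) ^ (3 / 4 : ℝ) * √(Real.pi / 5) * Real.exp (-(1 / 10)) * a * h ^ 2 =
      4 * ((2 : ℝ) ^ (1 / 4 : ℝ) * h ^ 2 * a) *
        (√(8 * Real.pi / 5) * Real.exp (-(1 / 10))) := by
  have h1 : √(8 * Real.pi / 5) = 2 * √2 * √(Real.pi / 5) := by
    rw [show 8 * Real.pi / 5 = 2 ^ 2 * (2 * (Real.pi / 5)) by ring,
      Real.sqrt_mul (by norm_num), Real.sqrt_sq (by norm_num), Real.sqrt_mul (by norm_num)]
    ring
  have h2 : (2 : ℝ) ^ (3 / 4 : ℝ) = (2 : ℝ) ^ (1 / 4 : ℝ) * √2 := by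
    rw [Real.sqrt_eq_rpow, ← Real.rpow_add (by norm_num)]
    norm_num
  rw [h1, h2]
  ring

lemma weighted_delta_expansion (H A : Matrix n n ℂ) :
    (fun β : ℝ => (∫ ω : ℝ, transitionWeight β ω *
        (4 * delta H A β ω + 2 * delta H A β ω ^ 2)) -
      8 * (2 : ℝ) ^ (3 / 4 : ℝ) * √(Real.pi / 5) * Real.exp (-(1 / 10)) * ‖A‖ * ‖H‖ ^ 2 *
        β ^ (3 / 2 : ℝ)) =O[𝓝[>] 0] fun β : ℝ => β ^ (5 / 2 : ℝ) := by
  have hpi := Real.pi_pos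
  set I := √(8 * Real.pi / 5) * Real.exp (-(1 / 10)) with hI
  set G := ∫ u : ℝ, transitionWeight 1 u with hG
  set c := (2 : ℝ) ^ (1 / 4 : ℝ) * ‖H‖ ^ 2 * ‖A‖ with hc
  set E := Real.exp (5 * ‖H‖ ^ 2) with hE
  set K := 1 / (2 ^ 5 * Real.pi) ^ (1 / 4 : ℝ) * (√Real.pi / 2) * (2 * ‖H‖) * ‖A‖ *
    (4 * ‖H‖ ^ 2 * E) with hK
  have hI0 : 0 ≤ I := by positivity
  have hG0 : 0 ≤ G := integral_nonneg fun u => transitionWeight_nonneg 1 u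
  have hc0 : 0 ≤ c := by positivity
  have hK0 : 0 ≤ K := by positivity
  refine IsBigO.of_bound ((8 * K + 2 * (c * E + 2 * K) ^ 2) * G + 4 * c * I * (5 * ‖H‖ ^ 2 * E)) ?_
  filter_upwards [Ioc_mem_nhdsGT (zero_lt_one (α := ℝ))] with β hβ
  obtain ⟨hβ0, hβ1⟩ := hβ
  have hr0 : 0 ≤ √β := Real.sqrt_nonneg β
  have hr1 : √β ≤ 1 := by simpa using Real.sqrt_le_sqrt hβ1
  have hβ2 : β ^ 2 ≤ 1 := pow_le_one₀ hβ0.le hβ1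
  have hx : ∀ k : ℝ, 0 ≤ k → k ≤ 5 →
      Real.exp (k * (β * ‖H‖) ^ 2) ≤ E := fun k hk0 hk => by
    refine Real.exp_le_exp.2 ?_
    rw [mul_pow]
    have : β ^ 2 * ‖H‖ ^ 2 ≤ ‖H‖ ^ 2 := mul_le_of_le_one_left (by positivity) hβ2
    exact mul_le_mul hk this (by positivity) (by norm_num)
  have hp : deltaEven H A β = c * (β ^ 2 * √β) * Real.exp (5 * (β * ‖H‖) ^ 2) := by
    rw [deltaEven_eq H A hβ0, hc]; ring
  have hp0 := deltaEven_nonneg H A hβ0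
  have hq0 : 0 ≤ deltaOdd H A β / β := div_nonneg (deltaOdd_nonneg H A hβ0) hβ0.le
  have hp1 : deltaEven H A β ≤ c * E * (β ^ 2 * √β) := by
    rw [hp, mul_right_comm]
    gcongr
    exact hx 5 (by norm_num) le_rfl
  have hq1 : deltaOdd H A β / β ≤ K * (β ^ 3 * √β) := by
    rw [div_le_iff₀ hβ0, deltaOdd, rpow_five_halves hβ0]
    have h1 : Real.exp (4 * β ^ 2 * ‖H‖ ^ 2) - 1 ≤ 4 * ‖H‖ ^ 2 * E * β ^ 2 := by
      have h2 := exp_sub_one_le_mul_exp (4 * β ^ 2 * ‖H‖ ^ 2)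
      have h3 := hx 4 (by norm_num) (by norm_num)
      rw [show 4 * (β * ‖H‖) ^ 2 = 4 * β ^ 2 * ‖H‖ ^ 2 by ring] at h3
      have h4 := mul_le_mul_of_nonneg_left h3 (by positivity : 0 ≤ 4 * β ^ 2 * ‖H‖ ^ 2)
      linarith
    calc β ^ 2 * √β / (2 ^ 5 * Real.pi) ^ (1 / 4 : ℝ) * (√Real.pi / 2) * (2 * ‖H‖) * ‖A‖ *
          (Real.exp (4 * β ^ 2 * ‖H‖ ^ 2) - 1)
        ≤ β ^ 2 * √β / (2 ^ 5 * Real.pi) ^ (1 / 4 : ℝ) * (√Real.pi / 2) * (2 * ‖H‖) * ‖A‖ *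
          (4 * ‖H‖ ^ 2 * E * β ^ 2) := by gcongr
      _ = K * (β ^ 3 * √β) * β := by rw [hK]; ring
  have hrem := abs_integral_weighted_sub_le hp0 hq0
  rw [integral_weighted_delta_eq H A hβ0, leading_coefficient_eq, rpow_three_halves hβ0,
    rpow_five_halves hβ0, ← hI, ← hc]
  rw [← hI, ← hG] at hrem
  set Z := ∫ u : ℝ, transitionWeight 1 u *
        (4 * (deltaEven H A β * Real.exp (-u ^ 2 / 8) +
          deltaOdd H A β / β * (|u| * Real.exp (-u ^ 2 / 4))) +
        2 * (deltaEven H A β * Real.exp (-u ^ 2 / 8) +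
          deltaOdd H A β / β * (|u| * Real.exp (-u ^ 2 / 4))) ^ 2)
  -- The first summand is the non-leading part of the integral; the second is the cost of replacing
  -- exp(5(β‖H‖)²) by 1 in δ_e.
  have e : β⁻¹ * Z - 4 * c * I * (β * √β) = β⁻¹ * (Z - 4 * deltaEven H A β * I) +
      4 * c * I * (β * √β) * (Real.exp (5 * (β * ‖H‖) ^ 2) - 1) := by
    rw [hp]
    field_simp
    ring
  rw [e]
  refine (norm_add_le _ _).trans ?_
  have t1 : ‖β⁻¹ * (Z - 4 * deltaEven H A β * I)‖ ≤
      (8 * K + 2 * (c * E + 2 * K) ^ 2) * G * (β ^ 2 * √β) := by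
    rw [norm_mul, norm_inv, Real.norm_of_nonneg hβ0.le, Real.norm_eq_abs, inv_mul_le_iff₀ hβ0]
    refine hrem.trans ?_
    have s1 : deltaEven H A β + 2 * (deltaOdd H A β / β) ≤
        (c * E + 2 * K) * (β ^ 2 * √β) := by
      have : K * (β ^ 3 * √β) ≤ K * (β ^ 2 * √β) := by
        gcongr K * (?_ * √β)
        exact pow_le_pow_of_le_one hβ0.le hβ1 (by norm_num)
      linarith
    have s2 : (deltaEven H A β + 2 * (deltaOdd H A β / β)) ^ 2 ≤
        (c * E + 2 * K) ^ 2 * (β ^ 3 * √β) := by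
      calc _ ≤ ((c * E + 2 * K) * (β ^ 2 * √β)) ^ 2 := by gcongr
        _ = (c * E + 2 * K) ^ 2 * (β ^ 3 * √β) * (β * √β) := by ring
        _ ≤ (c * E + 2 * K) ^ 2 * (β ^ 3 * √β) * 1 := by
          gcongr
          exact mul_le_one₀ hβ1 hr0 hr1
        _ = _ := mul_one _
    calc _ ≤ (8 * (K * (β ^ 3 * √β)) + 2 * ((c * E + 2 * K) ^ 2 * (β ^ 3 * √β))) * G := by
          gcongr
      _ = _ := by ring
  have t2 : ‖4 * c * I * (β * √β) * (Real.exp (5 * (β * ‖H‖) ^ 2) - 1)‖ ≤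
      4 * c * I * (5 * ‖H‖ ^ 2 * E) * (β ^ 2 * √β) := by
    have h1 : 0 ≤ Real.exp (5 * (β * ‖H‖) ^ 2) - 1 :=
      sub_nonneg.2 (Real.one_le_exp (by positivity))
    rw [Real.norm_of_nonneg (by positivity)]
    have h2 : Real.exp (5 * (β * ‖H‖) ^ 2) - 1 ≤ 5 * ‖H‖ ^ 2 * E * β := by
      calc _ ≤ 5 * (β * ‖H‖) ^ 2 * Real.exp (5 * (β * ‖H‖) ^ 2) := exp_sub_one_le_mul_exp _
        _ ≤ 5 * (β * ‖H‖) ^ 2 * E := by gcongr; exact hx 5 (by norm_num) le_rfl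
        _ = 5 * ‖H‖ ^ 2 * E * β * β := by ring
        _ ≤ 5 * ‖H‖ ^ 2 * E * β * 1 := by gcongr
        _ = _ := mul_one _
    calc _ ≤ 4 * c * I * (β * √β) * (5 * ‖H‖ ^ 2 * E * β) := by gcongr
      _ = _ := by ring
  rw [Real.norm_of_nonneg (by positivity : 0 ≤ β ^ 2 * √β)]
  linarith

variable {ι : Type*} [Fintype ι]

/-- The leading term of the error bound at high temperature. -/
theorem errorBound_expansion (H : Matrix n n ℂ) (A : ι → Matrix n n ℂ) :
    (fun β : ℝ => errorBound H A β -
        (∑ a, 8 * (2 : ℝ) ^ (3 / 4 : ℝ) * √(Real.pi / 5) * Real.exp (-(1 / 10)) *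
          ‖A a‖ * ‖H‖ ^ 2) * β ^ (3 / 2 : ℝ)) =O[𝓝[>] 0] fun β : ℝ => β ^ (5 / 2 : ℝ) := by
  simp only [errorBound, Finset.sum_mul, ← Finset.sum_sub_distrib]
  refine (IsBigO.sum (s := Finset.univ) fun a _ =>
    weighted_delta_expansion H (A a)).congr_left fun β => ?_
  rw [Finset.sum_apply]

lemma errorBound_isBigO (H : Matrix n n ℂ) (A : ι → Matrix n n ℂ) :
    errorBound H A =O[𝓝[>] 0] fun β : ℝ => β ^ (3 / 2 : ℝ) := by
  have h1 : (fun β : ℝ => β ^ (5 / 2 : ℝ)) =O[𝓝[>] 0] fun β : ℝ => β ^ (3 / 2 : ℝ) := by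
    refine IsBigO.of_bound 1 ?_
    filter_upwards [Ioc_mem_nhdsGT (zero_lt_one (α := ℝ))] with β hβ
    rw [Real.norm_of_nonneg (Real.rpow_nonneg hβ.1.le _),
      Real.norm_of_nonneg (Real.rpow_nonneg hβ.1.le _), one_mul]
    exact Real.rpow_le_rpow_of_exponent_ge hβ.1 hβ.2 (by norm_num)
  have h2 := ((errorBound_expansion H A).trans h1).add
    (isBigO_const_mul_self (∑ a, 8 * (2 : ℝ) ^ (3 / 4 : ℝ) * √(Real.pi / 5) *
      Real.exp (-(1 / 10)) * ‖A a‖ * ‖H‖ ^ 2) (fun β : ℝ => β ^ (3 / 2 : ℝ)) (𝓝[>] 0))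
  simpa using h2

lemma exists_errorBound_le (H : Matrix n n ℂ) (A : ι → Matrix n n ℂ) :
    ∃ C : ℝ, 0 ≤ C ∧ ∀ᶠ β in 𝓝[>] (0 : ℝ), errorBound H A β ≤ C * β ^ (3 / 2 : ℝ) := by
  obtain ⟨C, hC, h⟩ := (errorBound_isBigO H A).exists_nonneg
  refine ⟨C, hC, ?_⟩
  filter_upwards [h.bound, self_mem_nhdsWithin] with β h1 hβ
  rw [Real.norm_of_nonneg (Real.rpow_nonneg (le_of_lt hβ) (3 / 2 : ℝ))] at h1
  exact (le_abs_self _).trans h1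

end Expansion

/-! ### Exact stationarity of the Gibbs state. -/

section DetailedBalance

/-- The overlap of two shifted filters against the transition weight. -/
noncomputable def filterOverlap (β x y : ℝ) : ℝ :=
  ∫ ω : ℝ, transitionWeight β ω * (filterHat β (ω - x) * filterHat β (ω - y))

lemma integrable_filterOverlap {β : ℝ} (hβ : 0 < β) (x y : ℝ) :
    Integrable fun ω : ℝ => transitionWeight β ω * (filterHat β (ω - x) * filterHat β (ω - y)) := by
  have hc := continuous_filterHat β
  refine ((integrable_transitionWeight hβ).mul_const (filterAmp β * filterAmp β)).mono'
    ?_ (Eventually.of_forall fun ω => ?_)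
  · have := continuous_transitionWeight β
    exact Continuous.aestronglyMeasurable (by fun_prop)
  · have h0 := transitionWeight_nonneg β ω
    have h1 := filterHat_nonneg hβ (ω - x)
    have h2 := filterHat_nonneg hβ (ω - y)
    rw [Real.norm_of_nonneg (by positivity)]
    have := filterAmp_nonneg hβ
    gcongr
    · exact filterHat_le hβ _
    · exact filterHat_le hβ _

/-- The Kubo–Martin–Schwinger symmetry of the filter overlaps. -/
lemma filterOverlap_neg (β x y : ℝ) :
    filterOverlap β x y = Real.exp (-(β * (x + y) / 2)) * filterOverlap β (-x) (-y) := by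
  -- After a shift by the midpoint (x + y)/2 the integrands agree pointwise. This works because the
  -- weight and the product of two filters have the same quadratic coefficient β²/2 in the exponent;
  -- the +1 in the weight produces the Boltzmann factor.
  rw [filterOverlap, filterOverlap, ← integral_const_mul,
    ← integral_add_right_eq_self (μ := volume) (fun ω : ℝ => transitionWeight β ω *
      (filterHat β (ω - x) * filterHat β (ω - y))) ((x + y) / 2)]
  congr 1
  ext ω
  simp only [transitionWeight, filterHat]
  have h : ∀ K a b c d a' b' c' : ℝ, a + b + c = d + a' + b' + c' →
      Real.exp a * (K * Real.exp b * (K * Real.exp c)) =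
        Real.exp d * (Real.exp a' * (K * Real.exp b' * (K * Real.exp c'))) := by
    intro K a b c d a' b' c' h
    have h2 := congrArg Real.exp h
    simp only [Real.exp_add] at h2
    linear_combination K ^ 2 * h2
  apply h
  ring

variable {n ι : Type*} [Fintype n] [DecidableEq n] [Fintype ι]
  {H : Matrix n n ℂ} (hH : H.IsHermitian)

/-- The jump operator in an eigenbasis of the Hamiltonian. -/
noncomputable def eigenJump (A : Matrix n n ℂ) (β ω : ℝ) : Matrix n n ℂ :=
  Matrix.of fun i j => (filterHat β (ω - (hH.eigenvalues i - hH.eigenvalues j)) : ℂ) *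
    (ofEigenbasis hH).symm A i j

lemma jump_eq_eigenJump {β : ℝ} (hβ : 0 < β) (A : Matrix n n ℂ) (ω : ℝ) :
    jump H A β ω = ofEigenbasis hH (eigenJump hH A β ω) := jump_eq hH hβ A ω

/-- A matrix entry in the eigenbasis, as a continuous linear map. -/
noncomputable def eigenEntry (i j : n) : Matrix n n ℂ →L[ℂ] ℂ :=
  (entryCLM i j).comp (LinearMap.toContinuousLinearMap
    { toFun := (ofEigenbasis hH).symm
      map_add' := map_add _
      map_smul' := fun c X => map_smul _ c X })

lemma eigenEntry_apply (i j : n) (X : Matrix n n ℂ) :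
    eigenEntry hH i j X = (ofEigenbasis hH).symm X i j := rfl

lemma eigenEntry_ofEigenbasis (i j : n) (X : Matrix n n ℂ) :
    eigenEntry hH i j (ofEigenbasis hH X) = X i j := by
  rw [eigenEntry_apply, StarAlgEquiv.symm_apply_apply]

lemma eq_zero_of_eigenEntry {X : Matrix n n ℂ} (h : ∀ i j, eigenEntry hH i j X = 0) : X = 0 := by
  have h0 : (ofEigenbasis hH).symm X = 0 := Matrix.ext h
  rw [← StarAlgEquiv.apply_symm_apply (ofEigenbasis hH) X, h0, map_zero]

omit [DecidableEq n] in
lemma weight_mul_sum_filters_integral {β : ℝ} (hβ : 0 < β) (x y : n → ℝ) (z : n → ℂ) :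
    Integrable (fun ω : ℝ => (transitionWeight β ω : ℂ) *
      ∑ k, (filterHat β (ω - x k) : ℂ) * (filterHat β (ω - y k) : ℂ) * z k) ∧
    ∫ ω : ℝ, (transitionWeight β ω : ℂ) *
      ∑ k, (filterHat β (ω - x k) : ℂ) * (filterHat β (ω - y k) : ℂ) * z k =
        ∑ k, (filterOverlap β (x k) (y k) : ℂ) * z k := by
  have e : ∀ ω : ℝ, (transitionWeight β ω : ℂ) *
      ∑ k, (filterHat β (ω - x k) : ℂ) * (filterHat β (ω - y k) : ℂ) * z k =
      ∑ k, ((transitionWeight β ω * (filterHat β (ω - x k) * filterHat β (ω - y k)) : ℝ) : ℂ) *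
        z k := fun ω => by
    rw [Finset.mul_sum]
    refine Finset.sum_congr rfl fun k _ => ?_
    push_cast
    ring
  have hi : ∀ k, Integrable fun ω : ℝ =>
      ((transitionWeight β ω * (filterHat β (ω - x k) * filterHat β (ω - y k)) : ℝ) : ℂ) * z k :=
    fun k => (integrable_filterOverlap hβ (x k) (y k)).ofReal.mul_const _
  simp_rw [e]
  refine ⟨integrable_finsetSum _ fun k _ => hi k, ?_⟩
  rw [integral_finsetSum _ fun k _ => hi k]
  refine Finset.sum_congr rfl fun k _ => ?_
  rw [integral_mul_const, integral_complex_ofReal, filterOverlap]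

lemma star_eigenJump_mul_eigenJump_apply (A : Matrix n n ℂ) (β ω : ℝ) (i j : n) :
    ((eigenJump hH A β ω)ᴴ * eigenJump hH A β ω) i j =
      ∑ k, (filterHat β (ω - (hH.eigenvalues k - hH.eigenvalues i)) : ℂ) *
        (filterHat β (ω - (hH.eigenvalues k - hH.eigenvalues j)) : ℂ) *
        (star ((ofEigenbasis hH).symm A k i) * (ofEigenbasis hH).symm A k j) := by
  rw [Matrix.mul_apply]
  refine Finset.sum_congr rfl fun k _ => ?_
  simp only [Matrix.conjTranspose_apply, eigenJump, Matrix.of_apply, star_mul', Complex.star_def,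
    Complex.conj_ofReal]
  ring

lemma eigenJump_mul_diagonal_mul_star_apply (A : Matrix n n ℂ) (β ω : ℝ) (P : n → ℂ) (i j : n) :
    (eigenJump hH A β ω * Matrix.diagonal P * (eigenJump hH A β ω)ᴴ) i j =
      ∑ k, (filterHat β (ω - (hH.eigenvalues i - hH.eigenvalues k)) : ℂ) *
        (filterHat β (ω - (hH.eigenvalues j - hH.eigenvalues k)) : ℂ) *
        (P k * ((ofEigenbasis hH).symm A i k * star ((ofEigenbasis hH).symm A j k))) := by
  rw [Matrix.mul_apply]
  refine Finset.sum_congr rfl fun k _ => ?_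
  simp only [Matrix.mul_diagonal, Matrix.conjTranspose_apply, eigenJump, Matrix.of_apply,
    star_mul', Complex.star_def, Complex.conj_ofReal]
  ring

/-- The contribution of a single jump family to the decay operator, in the eigenbasis. -/
noncomputable def eigenDecay (A : Matrix n n ℂ) (β : ℝ) (i j : n) : ℂ :=
  ∑ k, (filterOverlap β (hH.eigenvalues k - hH.eigenvalues i)
    (hH.eigenvalues k - hH.eigenvalues j) : ℂ) *
      (star ((ofEigenbasis hH).symm A k i) * (ofEigenbasis hH).symm A k j)

lemma eigenEntry_decayOperator (A : ι → Matrix n n ℂ) {β : ℝ} (hβ : 0 < β) (i j : n) :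
    eigenEntry hH i j (decayOperator H A β) = ∑ a, eigenDecay hH (A a) β i j := by
  have := FiniteDimensional.proper ℂ (Matrix n n ℂ)
  rw [decayOperator, map_sum]
  refine Finset.sum_congr rfl fun a _ => ?_
  obtain ⟨C, hC⟩ := exists_norm_jump_le hH hβ (A a)
  have hsq : Continuous fun L : Matrix n n ℂ => Lᴴ * L :=
    (continuous_id.matrix_conjTranspose).matrix_mul continuous_id
  have hi := integrable_transitionWeight_smul (𝕜 := ℂ) (E := Matrix n n ℂ) (F := Matrix n n ℂ) hβ
    (continuous_jump hH hβ (A a)) hC hsq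
  refine (ContinuousLinearMap.integral_comp_comm (eigenEntry hH i j) hi).symm.trans ?_
  rw [eigenDecay,
    ← (weight_mul_sum_filters_integral hβ _ _ _).2]
  congr 1
  ext ω
  rw [map_smul, smul_eq_mul, jump_eq_eigenJump hH hβ, ← ofEigenbasis_conjTranspose, ← map_mul,
    eigenEntry_ofEigenbasis, star_eigenJump_mul_eigenJump_apply]
  rfl

lemma eigenEntry_integral_dissipator (A : Matrix n n ℂ) {β : ℝ} (hβ : 0 < β) (P : n → ℂ)
    (i j : n) :
    eigenEntry hH i j ((∫ ω : ℝ, (transitionWeight β ω : ℂ) • dissipator (jump H A β ω))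
      (ofEigenbasis hH (Matrix.diagonal P))) =
    ∑ k, (filterOverlap β (hH.eigenvalues i - hH.eigenvalues k)
        (hH.eigenvalues j - hH.eigenvalues k) : ℂ) *
      (P k * ((ofEigenbasis hH).symm A i k * star ((ofEigenbasis hH).symm A j k))) -
    (1 / 2 : ℂ) * (P i + P j) * eigenDecay hH A β i j := by
  obtain ⟨C, hC⟩ := exists_norm_jump_le hH hβ A
  have hi := integrable_dissipator hβ (continuous_jump hH hβ A) hC
  have hc := ContinuousLinearMap.integral_comp_comm (E := Matrix n n ℂ →L[ℂ] Matrix n n ℂ)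
    ((eigenEntry hH i j).comp (ContinuousLinearMap.apply ℂ (Matrix n n ℂ)
      (ofEigenbasis hH (Matrix.diagonal P)))) hi
  refine hc.symm.trans ?_
  obtain ⟨i1, e1⟩ := weight_mul_sum_filters_integral hβ
    (fun k => hH.eigenvalues i - hH.eigenvalues k) (fun k => hH.eigenvalues j - hH.eigenvalues k)
    (fun k => P k * ((ofEigenbasis hH).symm A i k * star ((ofEigenbasis hH).symm A j k)))
  obtain ⟨i2, e2⟩ := weight_mul_sum_filters_integral hβ
    (fun k => hH.eigenvalues k - hH.eigenvalues i) (fun k => hH.eigenvalues k - hH.eigenvalues j)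
    (fun k => star ((ofEigenbasis hH).symm A k i) * (ofEigenbasis hH).symm A k j)
  rw [eigenDecay, ← e1, ← e2, ← integral_const_mul, ← integral_sub i1 (i2.const_mul _)]
  congr 1
  ext ω
  change eigenEntry hH i j (((transitionWeight β ω : ℂ) • dissipator (jump H A β ω))
      (ofEigenbasis hH (Matrix.diagonal P))) = _
  rw [_root_.smul_apply, map_smul, smul_eq_mul, jump_eq_eigenJump hH hβ,
    ofEigenbasis_dissipator, eigenEntry_ofEigenbasis, dissipator_apply, Matrix.sub_apply,
    Matrix.smul_apply, Matrix.add_apply, Matrix.mul_diagonal, Matrix.diagonal_mul,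
    eigenJump_mul_diagonal_mul_star_apply, star_eigenJump_mul_eigenJump_apply, smul_eq_mul]
  ring

lemma coherentTerm_eq (A : ι → Matrix n n ℂ) {β : ℝ} (hβ : 0 < β) :
    coherentTerm H hH A β = ofEigenbasis hH (Matrix.of fun i j => Complex.I / 2 *
      (Real.tanh (β * (hH.eigenvalues i - hH.eigenvalues j) / 4) : ℂ) *
        ∑ a, eigenDecay hH (A a) β i j) := by
  simp_rw [← eigenEntry_decayOperator hH A hβ, eigenEntry_apply, ofEigenbasis_symm_apply,
    ofEigenbasis_apply]
  rfl

/-- Replacing each jump by its adjoint brings the matrix elements of AᴴA into the order of the gain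
term A·Aᴴ, so the two can be compared entrywise. -/
lemma sum_eigenDecay_eq_of_perm (A : ι → Matrix n n ℂ) (σ : Equiv.Perm ι)
    (hσ : ∀ a, A (σ a) = (A a)ᴴ) (β : ℝ) (i j : n) :
    ∑ a, eigenDecay hH (A a) β i j = ∑ a, ∑ k,
      (filterOverlap β (hH.eigenvalues k - hH.eigenvalues i)
        (hH.eigenvalues k - hH.eigenvalues j) : ℂ) *
        ((ofEigenbasis hH).symm (A a) i k * star ((ofEigenbasis hH).symm (A a) j k)) := by
  rw [← Equiv.sum_comp σ]
  refine Finset.sum_congr rfl fun a _ => Finset.sum_congr rfl fun k _ => ?_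
  have h : (ofEigenbasis hH).symm (A (σ a)) = ((ofEigenbasis hH).symm (A a))ᴴ := by
    rw [hσ]
    exact map_star (ofEigenbasis hH).symm (A a)
  rw [h, Matrix.conjTranspose_apply, Matrix.conjTranspose_apply, star_star]

/-- This identity fixes the form of the coherent term: tanh(β(x − y)/4) is the ratio of difference
to sum of the square roots of the Boltzmann weights. -/
lemma tanh_mul_exp_add_exp (β x y : ℝ) :
    Real.tanh (β * (x - y) / 4) * (Real.exp (-(β * y) / 2) + Real.exp (-(β * x) / 2)) =
      Real.exp (-(β * y) / 2) - Real.exp (-(β * x) / 2) := by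
  set t := β * (x - y) / 4 with ht
  have h1 : Real.exp (-(β * y) / 2) = Real.exp (-(β * (x + y)) / 4) * Real.exp t := by
    rw [← Real.exp_add]; congr 1; rw [ht]; ring
  have h2 : Real.exp (-(β * x) / 2) = Real.exp (-(β * (x + y)) / 4) * Real.exp (-t) := by
    rw [← Real.exp_add]; congr 1; rw [ht]; ring
  have hc := (Real.cosh_pos t).ne'
  rw [h1, h2, Real.tanh_eq_sinh_div_cosh, div_mul_eq_mul_div, div_eq_iff hc, Real.sinh_eq,
    Real.cosh_eq]
  ring

/-- The Gibbs state is stationary for the ideal Lindbladian. -/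
theorem idealLindbladian_gibbsState (A : ι → Matrix n n ℂ) (σ : Equiv.Perm ι)
    (hσ : ∀ a, A (σ a) = (A a)ᴴ) {β : ℝ} (hβ : 0 < β) :
    idealLindbladian H hH A β (gibbsState H β) = 0 := by
  set E := hH.eigenvalues with hE
  rw [gibbsState, map_smul, exp_smul_eq hH]
  refine smul_eq_zero_of_right _ (eq_zero_of_eigenEntry hH fun i j => ?_)
  rw [idealLindbladian, lindbladian, _root_.add_apply,
    _root_.sum_apply, map_add, map_sum]
  simp_rw [eigenEntry_integral_dissipator hH _ hβ]
  rw [coherent_apply, coherentTerm_eq hH A hβ, ← map_mul, ← map_mul, ← map_sub, ← map_smul,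
    eigenEntry_ofEigenbasis, Finset.sum_sub_distrib, ← Finset.mul_sum, Matrix.smul_apply,
    Matrix.sub_apply, Matrix.mul_diagonal, Matrix.diagonal_mul, Matrix.of_apply, smul_eq_mul]
  set r := ∑ a, eigenDecay hH (A a) β i j with hr
  set p : n → ℝ := fun i => Real.exp (-(β * E i) / 2) with hp
  have hPp : ∀ i, Complex.exp ((-β : ℂ) * E i) = (p i : ℂ) ^ 2 := fun i => by
    rw [hp, ← Complex.ofReal_pow, ← Real.exp_nat_mul, Complex.ofReal_exp]
    congr 1
    push_cast
    ring
  -- The gain term: the KMS factor of the overlap times pₖ² equals pᵢpⱼ, independently of k, and so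
  -- leaves the sum.
  have hT : ∑ a, ∑ k, (filterOverlap β (E i - E k) (E j - E k) : ℂ) *
      (Complex.exp ((-β : ℂ) * E k) *
        ((ofEigenbasis hH).symm (A a) i k * star ((ofEigenbasis hH).symm (A a) j k))) =
      (p i : ℂ) * (p j : ℂ) * r := by
    rw [hr, sum_eigenDecay_eq_of_perm hH A σ hσ, Finset.mul_sum]
    refine Finset.sum_congr rfl fun a _ => ?_
    rw [Finset.mul_sum]
    refine Finset.sum_congr rfl fun k _ => ?_
    have h1 : filterOverlap β (E i - E k) (E j - E k) * p k ^ 2 =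
        p i * p j * filterOverlap β (E k - E i) (E k - E j) := by
      rw [filterOverlap_neg, neg_sub, neg_sub]
      have h2 : Real.exp (-(β * (E i - E k + (E j - E k)) / 2)) * p k ^ 2 = p i * p j := by
        simp only [hp]
        rw [← Real.exp_nat_mul, ← Real.exp_add, ← Real.exp_add]
        congr 1
        push_cast
        ring
      linear_combination filterOverlap β (E k - E i) (E k - E j) * h2
    have h3 : (filterOverlap β (E i - E k) (E j - E k) : ℂ) * (p k : ℂ) ^ 2 =
        (p i : ℂ) * (p j : ℂ) * (filterOverlap β (E k - E i) (E k - E j) : ℂ) := by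
      exact_mod_cast congrArg (Complex.ofReal) h1
    rw [hPp]
    linear_combination ((ofEigenbasis hH).symm (A a) i k *
      star ((ofEigenbasis hH).symm (A a) j k)) * h3
  have ht : (Real.tanh (β * (E i - E j) / 4) : ℂ) * ((p j : ℂ) + p i) = (p j : ℂ) - p i := by
    exact_mod_cast congrArg (Complex.ofReal) (tanh_mul_exp_add_exp β (E i) (E j))
  rw [hT, hPp, hPp]
  -- Gain minus loss is −(pᵢ − pⱼ)² r/2, and the commutator gives tanh·(pⱼ² − pᵢ²) r/2, which equals
  -- (pⱼ − pᵢ)² r/2 by `ht`.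
  linear_combination (1 / 2 * r * ((p j : ℂ) - p i)) * ht -
    (1 / 2 * (Real.tanh (β * (E i - E j) / 4) : ℂ) * r * ((p j : ℂ) ^ 2 - (p i : ℂ) ^ 2)) *
      Complex.I_mul_I

end DetailedBalance

/-! ### Asymptotic consequences as β → 0⁺. -/

section HighTemperature

variable {n ι : Type*} [Fintype n] [DecidableEq n] [Fintype ι]
  {H : Matrix n n ℂ} (hH : H.IsHermitian)

include hH in
lemma eventually_forall_norm_truncatedJump_le_one (A : ι → Matrix n n ℂ) :
    ∀ᶠ β in 𝓝[>] (0 : ℝ), ∀ (a : ι) (ω : ℝ), ‖truncatedJump H (A a) β ω‖ ≤ 1 :=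
  eventually_all.2 fun a => eventually_norm_truncatedJump_le_one hH (A a)

/-- The diamond-norm error is of order `β^{3/2}` at high temperature. -/
theorem exists_diamondNorm_lindbladian_sub_le (A : ι → Matrix n n ℂ) :
    ∃ C : ℝ, 0 ≤ C ∧ ∀ᶠ β in 𝓝[>] (0 : ℝ),
      diamondNorm (idealLindbladian H hH A β - approxLindbladian H hH A β) ≤
        ENNReal.ofReal (C * β ^ (3 / 2 : ℝ)) := by
  obtain ⟨C, hC, h⟩ := exists_errorBound_le H A
  refine ⟨C, hC, ?_⟩
  filter_upwards [h, eventually_forall_norm_truncatedJump_le_one hH A, self_mem_nhdsWithin]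
    with β h1 h2 hβ
  exact (diamondNorm_lindbladian_sub_le hH A hβ h2).trans (ENNReal.ofReal_le_ofReal h1)

/-- Gives boundedness of the Gibbs state near β = 0 without using its positivity; nonemptiness makes
the trace at β = 0 nonzero. -/
lemma continuousAt_gibbsState_zero [Nonempty n] (H : Matrix n n ℂ) :
    ContinuousAt (gibbsState H) 0 := by
  let +nondep : NormedAlgebra ℚ (Matrix n n ℂ) := .restrictScalars ℚ ℂ _
  have h1 : Continuous fun β : ℝ => NormedSpace.exp ((-β : ℂ) • H) :=
    NormedSpace.exp_continuous.comp
      ((Complex.continuous_ofReal.neg).smul (continuous_const (y := H)))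
  have h2 : Continuous fun β : ℝ => (NormedSpace.exp ((-β : ℂ) • H)).trace := h1.matrix_trace
  refine (h2.continuousAt.inv₀ ?_).smul h1.continuousAt
  simp

lemma traceNorm_gibbsState_isBigO (H : Matrix n n ℂ) :
    (fun β : ℝ => traceNorm (gibbsState H β)) =O[𝓝[>] 0] fun _ => (1 : ℝ) := by
  rcases isEmpty_or_nonempty n with h | h
  · refine (isBigO_zero _ _).congr_left fun β => ?_
    simp [traceNorm]
  · have h1 : (gibbsState H) =O[𝓝[>] 0] fun _ => (1 : ℝ) :=
      ((continuousAt_gibbsState_zero H).tendsto.isBigO_one ℝ).mono nhdsWithin_le_nhds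
    refine IsBigO.trans (IsBigO.of_bound (Fintype.card n) (Eventually.of_forall fun β => ?_)) h1
    rw [Real.norm_of_nonneg (traceNorm_nonneg _)]
    exact traceNorm_le_card_mul_norm _

/-- The Gibbs state is approximately stationary for the approximate Lindbladian at high
temperature. -/
theorem traceNorm_approxLindbladian_gibbsState_isBigO (A : ι → Matrix n n ℂ) (σ : Equiv.Perm ι)
    (hσ : ∀ a, A (σ a) = (A a)ᴴ) :
    (fun β : ℝ => traceNorm (approxLindbladian H hH A β (gibbsState H β)))
      =O[𝓝[>] 0] fun β : ℝ => β ^ (3 / 2 : ℝ) := by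
  have h1 := (errorBound_isBigO H A).mul (traceNorm_gibbsState_isBigO H)
  simp only [mul_one] at h1
  refine IsBigO.trans (IsBigO.of_bound 1 ?_) h1
  filter_upwards [eventually_forall_norm_truncatedJump_le_one hH A, self_mem_nhdsWithin]
    with β h2 hβ
  have h3 := traceNorm_lindbladian_sub_apply_le hH A hβ h2 (gibbsState H β)
  rw [idealLindbladian_gibbsState hH A σ hσ hβ, zero_sub, traceNorm_neg] at h3
  rw [Real.norm_of_nonneg (traceNorm_nonneg _), one_mul]
  exact h3.trans (le_abs_self _)

end HighTemperature

end GibbsSampler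

theorem mainTheorem1 {n ι : Type*} [Fintype n] [DecidableEq n] [Fintype ι]
    (H : Matrix n n ℂ) (hH : H.IsHermitian) (A : ι → Matrix n n ℂ) :
    -- spectral-norm bound on the error of each jump operator
    (∀ β : ℝ, 0 < β → ∀ (a : ι) (ω : ℝ),
      ‖GibbsSampler.jump H (A a) β ω - GibbsSampler.truncatedJump H (A a) β ω‖ ≤
        GibbsSampler.delta H (A a) β ω) ∧
    -- diamond-norm bound, for truncated jumps of norm at most one
    (∀ β : ℝ, 0 < β → (∀ (a : ι) (ω : ℝ), ‖GibbsSampler.truncatedJump H (A a) β ω‖ ≤ 1) →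
      GibbsSampler.diamondNorm
        (GibbsSampler.idealLindbladian H hH A β - GibbsSampler.approxLindbladian H hH A β) ≤
          ENNReal.ofReal (GibbsSampler.errorBound H A β)) ∧
    -- the normalization holds at all sufficiently high temperatures
    (∀ᶠ β in 𝓝[>] (0 : ℝ), ∀ (a : ι) (ω : ℝ),
      ‖GibbsSampler.truncatedJump H (A a) β ω‖ ≤ 1) ∧
    -- expansion of the bound as `β → 0`
    ((fun β : ℝ => GibbsSampler.errorBound H A β -
        (∑ a, 8 * (2 : ℝ) ^ (3 / 4 : ℝ) * √(Real.pi / 5) * Real.exp (-(1 / 10)) *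
          ‖A a‖ * ‖H‖ ^ 2) * β ^ (3 / 2 : ℝ)) =O[𝓝[>] 0] fun β : ℝ => β ^ (5 / 2 : ℝ)) ∧
    -- the diamond-norm error is `O(β^{3/2})`, hence `O(β)`
    (∃ C : ℝ, ∀ᶠ β in 𝓝[>] (0 : ℝ), GibbsSampler.diamondNorm
        (GibbsSampler.idealLindbladian H hH A β - GibbsSampler.approxLindbladian H hH A β) ≤
          ENNReal.ofReal (C * β ^ (3 / 2 : ℝ))) ∧
    (∃ C : ℝ, ∀ᶠ β in 𝓝[>] (0 : ℝ), GibbsSampler.diamondNorm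
        (GibbsSampler.idealLindbladian H hH A β - GibbsSampler.approxLindbladian H hH A β) ≤
          ENNReal.ofReal (C * β)) ∧
    -- for jumps closed under adjoints, the Gibbs state is stationary for the ideal Lindbladian and
    -- approximately stationary for the approximate one
    ((∃ σ : Equiv.Perm ι, ∀ a, A (σ a) = (A a)ᴴ) →
      (∀ β : ℝ, 0 < β →
        GibbsSampler.idealLindbladian H hH A β (GibbsSampler.gibbsState H β) = 0) ∧
      (fun β : ℝ => GibbsSampler.traceNorm
        (GibbsSampler.approxLindbladian H hH A β (GibbsSampler.gibbsState H β)))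
          =O[𝓝[>] 0] fun β : ℝ => β ^ (3 / 2 : ℝ)) := by
  refine ⟨fun β hβ a ω => GibbsSampler.norm_jump_sub_truncatedJump_le hH hβ (A a) ω,
    fun β hβ hA => GibbsSampler.diamondNorm_lindbladian_sub_le hH A hβ hA,
    GibbsSampler.eventually_forall_norm_truncatedJump_le_one hH A,
    GibbsSampler.errorBound_expansion H A, ?_, ?_, ?_⟩
  · obtain ⟨C, -, h⟩ := GibbsSampler.exists_diamondNorm_lindbladian_sub_le hH A
    exact ⟨C, h⟩
  · obtain ⟨C, hC, h⟩ := GibbsSampler.exists_diamondNorm_lindbladian_sub_le hH A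
    refine ⟨C, ?_⟩
    filter_upwards [h, Ioc_mem_nhdsGT (zero_lt_one (α := ℝ))] with β h1 hβ
    refine h1.trans (ENNReal.ofReal_le_ofReal (mul_le_mul_of_nonneg_left ?_ hC))
    have h2 := Real.rpow_le_rpow_of_exponent_ge hβ.1 hβ.2 (by norm_num : (1 : ℝ) ≤ 3 / 2)
    rwa [Real.rpow_one] at h2
  · rintro ⟨σ, hσ⟩
    exact ⟨fun β hβ => GibbsSampler.idealLindbladian_gibbsState hH A σ hσ hβ,
      GibbsSampler.traceNorm_approxLindbladian_gibbsState_isBigO hH A σ hσ⟩
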